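/- Let $\mathcal X$ and $\mathcal C$ be confocal ellipses in the Euclidean plane (concentric circles allowed), $\mathcal X$ inside $\mathcal C$, with common center $O$. Let $m\ge 3$ and let $(p_i)_{i\in\mathbb Z/m}$ be a Poncelet $m$-gon for them: the $p_i$ are $m$ distinct points of $\mathcal C$, and every line $\ell_i=p_i\vee p_{i+1}$ is tangent to $\mathcal X$ (star polygons are allowed). All indices are taken modulo $m$. Put $L=(\ell_i)_{i\in\mathbb Z/m}$. Represent each point of the projective plane by two antipodal points of the sphere, a positive and a negative one. Let $H_i^+$ be the open half-sphere bounded by $\ell_i$ that contains the positive representative of $O$, and let $H_i^-=-H_i^+$. In the affine plane, $H_i^+$ thus consists of the positive points on the side of $\ell_i$ containing $O$ and the negative points on the other side. The combinatorial square cell of type $(k,l)$ at position $i$ is the region of the projective plane represented by $$H_i^+\cap H_{i+l}^-\cap H_{i+k}^-\cap H_{i+k+l}^+ .$$ An incircle of it is a circle of positive radius that is tangent to the lines $\ell_i,\ell_{i+l},\ell_{i+k},\ell_{i+k+l}$ and whose interior lies in the cell. (1) For all $i,k,l\in\mathbb Z/m$ with $2k\ne0$ and $2l\neq 0$ in $\mathbb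 Z/m$ (that is, $k,l\notin\{0,m/2\}$), the square cell of type $(k,l)$ at position $i$ has exactly one incircle. Denote its center by ${}_i\odot_{k,l}$. (2) For all $i,k\in\mathbb Z/m$ with $2k\neq 0$, the centers ${}_i\odot_{k,l}$, with $l$ ranging over all $l\in\mathbb Z/m$ with $2l\ne 0$, are collinear. (All these circles are tangent to both $\ell_i$ and $\ell_{i+k}$ and lie in the same double wedge of these two lines.) (3) Let $a,b,c$ be three distinct positive integers smaller than $m/2$. Then $$\mathcal P=\{{}_i\odot_{a,b}\mid i\in\mathbb Z/m\}\cup\{{}_i\odot_{b,c}\mid i\in\mathbb Z/m\}\cup\{{}_i\odot_{c,a}\mid i\in\mathbb Z/m\}$$ is the point set of a pre-$(n_4)$ configuration with $n=3m$: $\mathcal P$ consists of $3m$ distinct points, and there are $3m$ distinct lines such that every one of these lines contains at least four points of $\mathcal P$ and every point of $\mathcal P$ lies on at least four of these lines. These lines are the lines spanned by the collinear sets in (2) for $i\in\mathbb Z/m$ and $k\in\{a,b,c\}$. -/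

import Mathlib

noncomputable section

namespace PonceletIncircle

/-- The Euclidean plane. -/
abbrev Plane := EuclideanSpace ℝ (Fin 2)

/-- The ellipse with foci `F₁`, `F₂` and semi-major axis `s`
(a genuine ellipse, or a circle if `F₁ = F₂`, as soon as `dist F₁ F₂ < 2 * s`).
Ellipses with the same two foci are confocal. -/
def ellipse (F₁ F₂ : Plane) (s : ℝ) : Set Plane :=
  {x | dist x F₁ + dist x F₂ = 2 * s}

/-- The line supporting the `i`-th side of the closed polygon `p`. -/
def side {m : ℕ} (p : ZMod m → Plane) (i : ZMod m) : AffineSubspace ℝ Plane :=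
  line[ℝ, p i, p (i + 1)]

/-- A line is tangent to an ellipse if it meets it in exactly one point. -/
def IsTangentToEllipse (E : Set Plane) (ℓ : AffineSubspace ℝ Plane) : Prop :=
  ∃! x, x ∈ ℓ ∧ x ∈ E

/-- A Poncelet `m`-gon, possibly a star polygon: `m` distinct vertices, inscribed in the ellipse
`C`, with all sides tangent to the ellipse `X`. Indices are taken modulo `m`. -/
structure IsPonceletPolygon {m : ℕ} (C X : Set Plane) (p : ZMod m → Plane) : Prop where
  injective : Function.Injective p
  inscribed : ∀ i, p i ∈ C
  circumscribed : ∀ i, IsTangentToEllipse X (side p i)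

/-- A signed finite point of the projective plane: `(1, x)` and `(-1, x)` stand for the two
antipodal points of the unit sphere that represent `x`. -/
abbrev SignedPoint := ℤˣ × Plane

/-- The open halfspace `H⁺` of a line `ℓ`, oriented such that the point `O` is positive:
the positive points on the side of `O` and the negative points on the other side. -/
def posHalf (O : Plane) (ℓ : AffineSubspace ℝ Plane) : Set SignedPoint :=
  {q | (q.1 = 1 ∧ ℓ.SSameSide O q.2) ∨ (q.1 = -1 ∧ ℓ.SOppSide O q.2)}

/-- The open halfspace `H⁻` opposite to `posHalf O ℓ`. -/
def negHalf (O : Plane) (ℓ : AffineSubspace ℝ Plane) : Set SignedPoint :=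
  {q | (q.1 = 1 ∧ ℓ.SOppSide O q.2) ∨ (q.1 = -1 ∧ ℓ.SSameSide O q.2)}

/-- The oriented double wedge `H_i⁺ ∩ H_j⁻`. -/
def doubleWedge {ι : Type*} (O : Plane) (L : ι → AffineSubspace ℝ Plane) (i j : ι) :
    Set SignedPoint :=
  posHalf O (L i) ∩ negHalf O (L j)

/-- The cell with upper indices `a, b` and lower indices `c, d`, the intersection of two double
wedges, that is `H_a⁺ ∩ H_b⁻ ∩ H_d⁺ ∩ H_c⁻`. -/
def cell {ι : Type*} (O : Plane) (L : ι → AffineSubspace ℝ Plane) (a b c d : ι) :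
    Set SignedPoint :=
  doubleWedge O L a b ∩ doubleWedge O L d c

/-- `S` is an incircle of the cell: a proper circle that is tangent to the four lines and whose
interior lies in the cell, the latter regarded as a region of the plane by forgetting signs. -/
structure IsIncircle {ι : Type*} (O : Plane) (L : ι → AffineSubspace ℝ Plane) (a b c d : ι)
    (S : EuclideanGeometry.Sphere Plane) : Prop where
  radius_pos : 0 < S.radius
  tangent_a : S.IsTangent (L a)
  tangent_b : S.IsTangent (L b)
  tangent_c : S.IsTangent (L c)
  tangent_d : S.IsTangent (L d)
  interior_subset : Metric.ball S.center S.radius ⊆ Prod.snd '' cell O L a b c d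

/-- `S` is an incircle of the combinatorial square of type `(k, l)` at position `i`, which is the
cell with upper indices `i, i + l` and lower indices `i + k, i + k + l`. -/
def IsSquareIncircle {m : ℕ} (O : Plane) (L : ZMod m → AffineSubspace ℝ Plane) (i k l : ZMod m)
    (S : EuclideanGeometry.Sphere Plane) : Prop :=
  IsIncircle O L i (i + l) (i + k) (i + k + l) S

/-- The centers of the incircles of all square cells of type `(k, l)`. -/
def squareCenters {m : ℕ} (O : Plane) (L : ZMod m → AffineSubspace ℝ Plane) (k l : ZMod m) :
    Set Plane :=
  {z | ∃ (i : ZMod m) (S : EuclideanGeometry.Sphere Plane),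
    IsSquareIncircle O L i k l S ∧ S.center = z}

/-- The centers of the incircles of all square cells in the double wedge of the lines `i` and
`i + k`: the cells of types `(k, l)` at position `i`, where `l` is neither `0` nor `m / 2`
modulo `m`. All these circles are tangent to the lines `i` and `i + k`. -/
def wedgeCenters {m : ℕ} (O : Plane) (L : ZMod m → AffineSubspace ℝ Plane) (i k : ZMod m) :
    Set Plane :=
  {z | ∃ (l : ZMod m) (S : EuclideanGeometry.Sphere Plane),
    2 * l ≠ 0 ∧ IsSquareIncircle O L i k l S ∧ S.center = z}

/-- `n` points and `n` lines such that every line contains at least four of the points and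
every point lies on at least four of the lines. -/
structure IsPreN4 (n : ℕ) (P : Set Plane) (Ls : Set (AffineSubspace ℝ Plane)) : Prop where
  card_points : P.encard = n
  card_lines : Ls.encard = n
  isLine : ∀ ℓ ∈ Ls, Module.finrank ℝ ℓ.direction = 1 ∧ (ℓ : Set Plane).Nonempty
  four_points : ∀ ℓ ∈ Ls, 4 ≤ {z ∈ P | z ∈ ℓ}.encard
  four_lines : ∀ z ∈ P, 4 ≤ {ℓ ∈ Ls | z ∈ ℓ}.encard

end PonceletIncircle

end

/-! Let $s$, $f$ and $\kappa=f/s$ be the semi-major axis, half focal distance and eccentricity of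
the inner ellipse. In its principal frame, the tangent with unit normal $(\cos\varphi,\sin\varphi)$
is at distance $s\sqrt{1-\kappa^2\sin^2\varphi}$ from $O$, so Jacobi functions of modulus $\kappa$
put the tangents in the form $\mathrm{cn}\,\theta\,x+\mathrm{sn}\,\theta\,y=s\,\mathrm{dn}\,\theta$.
If the tangents at $w\pm x$ meet on the confocal ellipse of semi-major axis $t$, then
$\mathrm{sn}^2x=(t^2-s^2)/(t^2-f^2)$ (`sn_sq_of_tangents_inter`). Consecutive sides of a Poncelet
polygon therefore differ by $\pm\tau$ modulo periods, and a change of sign would repeat a side. So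
$\ell_j$ is the tangent at $u+j\tau$ (`exists_isJacobiProgression`).

The core is `incircle_identity`: the point `gridPoint w α β` has signed distance `gridRadius w α β`
from the tangent at $w+\alpha+\beta$. The point is even and the radius odd in each of $\alpha$,
$\beta$, so the tangents at $w\pm\alpha\pm\beta$ touch one circle, with exactly the signs required
by a square cell. Taking $\alpha=k\tau/2$, $\beta=l\tau/2$ and $w=u+(i+(k+l)/2)\tau$ gives the
incircle. It is unique because the difference of two centers has the same inner product with the
unit vectors $n_1,n_4,-n_2,-n_3$, and a line meets the unit circle at most twice (`center_unique`).

The centers in (2) have opposite signed distances from $\ell_i$ and $\ell_{i+k}$, hence lie on one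
bisector. The center of type $(k,l)$ at position $i$ lies on the bisectors of $(\ell_i,\ell_{i+k})$,
$(\ell_{i+l},\ell_{i+k+l})$, $(\ell_i,\ell_{i+l})$ and $(\ell_{i+k},\ell_{i+k+l})$, which gives the
incidences in (3). It remains to see that nothing coincides. For fixed $\alpha$ the grid points are
an affine image of the intersections of the tangents at $w\pm\beta$, and these lie on nested
confocal ellipses (`cn_sq_eq_of_nested`). Coincidence of bisectors leads to the same pair of
equations. -/

noncomputable section

namespace PonceletIncircle

/-! ### Construction of Jacobi's functions and their addition theorems. -/

/-- Jacobi's elliptic functions of modulus `κ`, characterised by their differential equations. -/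
structure JacobiFunctions (κ : ℝ) where
  sn : ℝ → ℝ
  cn : ℝ → ℝ
  dn : ℝ → ℝ
  sn_zero : sn 0 = 0
  cn_zero : cn 0 = 1
  dn_pos : ∀ u, 0 < dn u
  cn_sq : ∀ u, cn u ^ 2 = 1 - sn u ^ 2
  dn_sq : ∀ u, dn u ^ 2 = 1 - κ ^ 2 * sn u ^ 2
  hasDerivAt_sn : ∀ u, HasDerivAt sn (cn u * dn u) u
  hasDerivAt_cn : ∀ u, HasDerivAt cn (-(sn u * dn u)) u
  hasDerivAt_dn : ∀ u, HasDerivAt dn (-(κ ^ 2 * sn u * cn u)) u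
  exists_eq : ∀ c s : ℝ, c ^ 2 + s ^ 2 = 1 → ∃ u, cn u = c ∧ sn u = s

/-- The amplitude function: the inverse of the elliptic integral of the first kind. -/
theorem exists_amplitude {κ : ℝ} (h0 : 0 ≤ κ) (h1 : κ < 1) :
    ∃ φ : ℝ → ℝ, φ 0 = 0 ∧ Function.Surjective φ ∧
      ∀ u, HasDerivAt φ (√(1 - κ ^ 2 * Real.sin (φ u) ^ 2)) u := by
  have hpos : ∀ θ : ℝ, 0 < 1 - κ ^ 2 * Real.sin θ ^ 2 := fun θ => by
    nlinarith [Real.sin_sq_le_one θ, sq_nonneg (Real.sin θ), mul_nonneg h0 h0]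
  set g : ℝ → ℝ := fun θ => (√(1 - κ ^ 2 * Real.sin θ ^ 2))⁻¹ with hg
  have hgc : Continuous g := by
    refine Continuous.inv₀ (by fun_prop) fun θ => (Real.sqrt_pos.2 (hpos θ)).ne'
  have hg1 : ∀ θ, 1 ≤ g θ := fun θ => by
    refine (one_le_inv₀ (Real.sqrt_pos.2 (hpos θ))).2 (Real.sqrt_le_one.2 ?_)
    nlinarith [sq_nonneg (κ * Real.sin θ)]
  set F : ℝ → ℝ := fun θ => ∫ x in (0 : ℝ)..θ, g x with hF
  have hd : ∀ θ, HasDerivAt F (g θ) θ := fun θ =>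
    intervalIntegral.integral_hasDerivAt_right (hgc.intervalIntegrable _ _)
      (hgc.stronglyMeasurableAtFilter _ _) hgc.continuousAt
  have hmono : StrictMono F := strictMono_of_deriv_pos fun θ => by
    rw [(hd θ).deriv]; linarith [hg1 θ]
  have hFc : Continuous F := continuous_iff_continuousAt.2 fun θ => (hd θ).continuousAt
  -- The integrand is at least 1, so $F$ grows at least as fast as the identity and is onto.
  have hmono' : Monotone fun θ => F θ - θ := by
    refine monotone_of_deriv_nonneg (fun θ => ((hd θ).sub (hasDerivAt_id θ)).differentiableAt)
      fun θ => ?_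
    have := ((hd θ).sub (hasDerivAt_id θ)).deriv
    have h2 : deriv (fun θ => F θ - θ) θ = g θ - 1 := this
    rw [h2]; linarith [hg1 θ]
  have hF0 : F 0 = 0 := by simp [hF]
  have hsurj : Function.Surjective F := by
    refine hFc.surjective ?_ ?_
    · refine Filter.tendsto_atTop_mono' _ ?_ Filter.tendsto_id
      filter_upwards [Filter.eventually_ge_atTop 0] with θ hθ
      have := hmono' hθ
      simp only [hF0, id] at this ⊢; linarith
    · refine Filter.tendsto_atBot_mono' _ ?_ Filter.tendsto_id
      filter_upwards [Filter.eventually_le_atBot 0] with θ hθ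
      have := hmono' hθ
      simp only [hF0, id] at this ⊢; linarith
  set e := hmono.orderIsoOfSurjective F hsurj with he
  have heF : ∀ θ, e θ = F θ := fun θ => rfl
  refine ⟨e.symm, ?_, e.symm.surjective, fun u => ?_⟩
  · rw [OrderIso.symm_apply_eq, heF, hF0]
  · have := HasDerivAt.of_local_left_inverse (f := F) (g := e.symm) (a := u)
      e.symm.continuous.continuousAt (hd _) (by linarith [hg1 (e.symm u)])
      (Filter.Eventually.of_forall fun x => by rw [← heF, OrderIso.apply_symm_apply])
    simpa [hg] using this

theorem nonempty_jacobiFunctions {κ : ℝ} (h0 : 0 ≤ κ) (h1 : κ < 1) :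
    Nonempty (JacobiFunctions κ) := by
  obtain ⟨φ, hφ0, hsurj, hφ⟩ := exists_amplitude h0 h1
  have hpos : ∀ θ : ℝ, 0 < 1 - κ ^ 2 * Real.sin θ ^ 2 := fun θ => by
    nlinarith [Real.sin_sq_le_one θ, sq_nonneg (Real.sin θ), mul_nonneg h0 h0]
  refine ⟨⟨fun u => Real.sin (φ u), fun u => Real.cos (φ u),
    fun u => √(1 - κ ^ 2 * Real.sin (φ u) ^ 2), by simp [hφ0], by simp [hφ0],
    fun u => Real.sqrt_pos.2 (hpos _), fun u => Real.cos_sq' _,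
    fun u => Real.sq_sqrt (hpos _).le, fun u => (hφ u).sin, fun u => ?_, fun u => ?_, ?_⟩⟩
  · simpa using (hφ u).cos
  · have h := ((((hφ u).sin.pow 2).const_mul (κ ^ 2)).const_sub 1).sqrt (hpos _).ne'
    refine h.congr_deriv ?_
    have := (Real.sqrt_pos.2 (hpos (φ u))).ne'
    simp only [Pi.pow_apply]
    field_simp
    norm_num
    ring
  · intro c s h
    have hn : ‖(⟨c, s⟩ : ℂ)‖ = 1 := by
      rw [Complex.norm_eq_sqrt_sq_add_sq, h, Real.sqrt_one]
    obtain ⟨u, hu⟩ := hsurj (Complex.arg ⟨c, s⟩)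
    have hne : (⟨c, s⟩ : ℂ) ≠ 0 := by
      intro h0; rw [h0] at hn; simp at hn
    refine ⟨u, ?_, ?_⟩
    · simp [hu, Complex.cos_arg hne, hn]
    · simp [hu, Complex.sin_arg, hn]

namespace JacobiFunctions

variable {κ : ℝ} (J : JacobiFunctions κ)

theorem dn_zero : J.dn 0 = 1 := by
  have := J.dn_sq 0
  rw [J.sn_zero] at this
  nlinarith [J.dn_pos 0]

theorem sn_sq_le_one (u : ℝ) : J.sn u ^ 2 ≤ 1 := by
  linarith [J.cn_sq u, sq_nonneg (J.cn u)]

/-- The common denominator of the addition formulas. -/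
theorem denom_pos (hκ : κ ^ 2 < 1) (u v : ℝ) : 0 < 1 - κ ^ 2 * J.sn u ^ 2 * J.sn v ^ 2 := by
  have h1 := mul_le_one₀ (J.sn_sq_le_one u) (sq_nonneg (J.sn v)) (J.sn_sq_le_one v)
  have h2 := mul_le_mul_of_nonneg_left h1 (sq_nonneg κ)
  nlinarith

/-- A quotient of functions with vanishing Wronskian is constant. -/
theorem div_eq_div_of_wronskian {N M N' M' : ℝ → ℝ} (hN : ∀ u, HasDerivAt N (N' u) u)
    (hM : ∀ u, HasDerivAt M (M' u) u) (h0 : ∀ u, M u ≠ 0)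
    (hW : ∀ u, N' u * M u - N u * M' u = 0) (u v : ℝ) : N u / M u = N v / M v := by
  refine is_const_of_deriv_eq_zero (f := fun u => N u / M u)
    (fun x => ((hN x).div (hM x) (h0 x)).differentiableAt) (fun x => ?_) u v
  have := ((hN x).div (hM x) (h0 x)).deriv
  rw [hW x, zero_div] at this
  exact this

section addition

variable (a u : ℝ)

theorem hasDerivAt_const_sub {f : ℝ → ℝ} {f' : ℝ} (h : HasDerivAt f f' (a - u)) :
    HasDerivAt (fun x => f (a - x)) (-f') u := by
  have := HasDerivAt.comp u h ((hasDerivAt_id u).const_sub a)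
  rw [mul_neg_one] at this
  exact this

theorem hasDerivAt_denom : HasDerivAt (fun x => 1 - κ ^ 2 * J.sn x ^ 2 * J.sn (a - x) ^ 2)
    (-2 * κ ^ 2 * J.sn u * J.sn (a - u) *
      (J.cn u * J.dn u * J.sn (a - u) - J.sn u * (J.cn (a - u) * J.dn (a - u)))) u := by
  have h := ((((J.hasDerivAt_sn u).pow 2).const_mul (κ ^ 2)).mul
    ((hasDerivAt_const_sub a u (J.hasDerivAt_sn (a - u))).pow 2)).const_sub 1
  refine h.congr_deriv ?_
  norm_num
  ring

end addition

/-- With $x+y$ held fixed, the right-hand side and the denominator, as functions of the first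
argument, have vanishing Wronskian, so their quotient is constant; its values at $x$ and at $0$ are
compared. The Wronskian vanishes by the quadratic relations at the two arguments alone. `cn_add` and
`dn_add` follow the same pattern. -/
theorem sn_add (hκ : κ ^ 2 < 1) (x y : ℝ) :
    J.sn (x + y) * (1 - κ ^ 2 * J.sn x ^ 2 * J.sn y ^ 2) =
      J.sn x * (J.cn y * J.dn y) + J.sn y * (J.cn x * J.dn x) := by
  have key := div_eq_div_of_wronskian
    (N := fun u => J.sn u * (J.cn (x + y - u) * J.dn (x + y - u)) +
      J.sn (x + y - u) * (J.cn u * J.dn u))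
    (fun u => ((J.hasDerivAt_sn u).mul ((hasDerivAt_const_sub _ u (J.hasDerivAt_cn _)).mul
      (hasDerivAt_const_sub _ u (J.hasDerivAt_dn _)))).add
      ((hasDerivAt_const_sub _ u (J.hasDerivAt_sn _)).mul
        ((J.hasDerivAt_cn u).mul (J.hasDerivAt_dn u))))
    (J.hasDerivAt_denom (x + y)) (fun u => (J.denom_pos hκ _ _).ne') (fun u => ?_) x 0
  · have := (J.denom_pos hκ x y).ne'
    simp only [add_sub_cancel_left, sub_zero, J.sn_zero, J.cn_zero, J.dn_zero] at key
    rw [div_eq_iff this] at key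
    linear_combination -key
  · have h1 := J.cn_sq u
    have h2 := J.cn_sq (x + y - u)
    have h3 := J.dn_sq u
    have h4 := J.dn_sq (x + y - u)
    simp only [Pi.mul_apply]
    generalize J.sn u = s at *
    generalize J.cn u = c at *
    generalize J.dn u = d at *
    generalize J.sn (x + y - u) = s' at *
    generalize J.cn (x + y - u) = c' at *
    generalize J.dn (x + y - u) = d' at *
    grind

theorem cn_add (hκ : κ ^ 2 < 1) (x y : ℝ) :
    J.cn (x + y) * (1 - κ ^ 2 * J.sn x ^ 2 * J.sn y ^ 2) =
      J.cn x * J.cn y - J.sn x * J.dn x * (J.sn y * J.dn y) := by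
  have key := div_eq_div_of_wronskian
    (N := fun u => J.cn u * J.cn (x + y - u) -
      J.sn u * J.dn u * (J.sn (x + y - u) * J.dn (x + y - u)))
    (fun u => ((J.hasDerivAt_cn u).mul (hasDerivAt_const_sub _ u (J.hasDerivAt_cn _))).sub
      (((J.hasDerivAt_sn u).mul (J.hasDerivAt_dn u)).mul
        ((hasDerivAt_const_sub _ u (J.hasDerivAt_sn _)).mul
          (hasDerivAt_const_sub _ u (J.hasDerivAt_dn _)))))
    (J.hasDerivAt_denom (x + y)) (fun u => (J.denom_pos hκ _ _).ne') (fun u => ?_) x 0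
  · have := (J.denom_pos hκ x y).ne'
    simp only [add_sub_cancel_left, sub_zero, J.sn_zero, J.cn_zero, J.dn_zero] at key
    rw [div_eq_iff this] at key
    linear_combination -key
  · have h1 := J.cn_sq u
    have h2 := J.cn_sq (x + y - u)
    have h3 := J.dn_sq u
    have h4 := J.dn_sq (x + y - u)
    simp only [Pi.mul_apply]
    generalize J.sn u = s at *
    generalize J.cn u = c at *
    generalize J.dn u = d at *
    generalize J.sn (x + y - u) = s' at *
    generalize J.cn (x + y - u) = c' at *
    generalize J.dn (x + y - u) = d' at *
    grind

theorem dn_add (hκ : κ ^ 2 < 1) (x y : ℝ) :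
    J.dn (x + y) * (1 - κ ^ 2 * J.sn x ^ 2 * J.sn y ^ 2) =
      J.dn x * J.dn y - κ ^ 2 * (J.sn x * J.cn x * (J.sn y * J.cn y)) := by
  have key := div_eq_div_of_wronskian
    (N := fun u => J.dn u * J.dn (x + y - u) -
      κ ^ 2 * (J.sn u * J.cn u * (J.sn (x + y - u) * J.cn (x + y - u))))
    (fun u => ((J.hasDerivAt_dn u).mul (hasDerivAt_const_sub _ u (J.hasDerivAt_dn _))).sub
      ((((J.hasDerivAt_sn u).mul (J.hasDerivAt_cn u)).mul
        ((hasDerivAt_const_sub _ u (J.hasDerivAt_sn _)).mul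
          (hasDerivAt_const_sub _ u (J.hasDerivAt_cn _)))).const_mul (κ ^ 2)))
    (J.hasDerivAt_denom (x + y)) (fun u => (J.denom_pos hκ _ _).ne') (fun u => ?_) x 0
  · have := (J.denom_pos hκ x y).ne'
    simp only [add_sub_cancel_left, sub_zero, J.sn_zero, J.cn_zero, J.dn_zero] at key
    rw [div_eq_iff this] at key
    linear_combination -key
  · have h1 := J.cn_sq u
    have h2 := J.cn_sq (x + y - u)
    have h3 := J.dn_sq u
    have h4 := J.dn_sq (x + y - u)
    simp only [Pi.mul_apply]
    generalize J.sn u = s at *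
    generalize J.cn u = c at *
    generalize J.dn u = d at *
    generalize J.sn (x + y - u) = s' at *
    generalize J.cn (x + y - u) = c' at *
    generalize J.dn (x + y - u) = d' at *
    grind

end JacobiFunctions

end PonceletIncircle

end

/-! ### Product formulas, parity and periods of Jacobi's functions. -/

noncomputable section

namespace PonceletIncircle

namespace JacobiFunctions

variable {κ : ℝ} (J : JacobiFunctions κ)

/-- Apart from `sn x * sn y`, the right-hand side depends on $x+y$ only. This and `dn_mul_dn` make
pairs of arguments with equal sums comparable. -/
theorem cn_mul_cn (hκ : κ ^ 2 < 1) (x y : ℝ) :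
    J.cn x * J.cn y = J.cn (x + y) + J.sn x * J.sn y * J.dn (x + y) := by
  have h := (J.denom_pos hκ x y).ne'
  have h1 := J.cn_add hκ x y
  have h2 := J.dn_add hκ x y
  refine mul_right_cancel₀ h ?_
  linear_combination -h1 - J.sn x * J.sn y * h2

theorem dn_mul_dn (hκ : κ ^ 2 < 1) (x y : ℝ) :
    J.dn x * J.dn y = J.dn (x + y) + κ ^ 2 * J.sn x * J.sn y * J.cn (x + y) := by
  have h := (J.denom_pos hκ x y).ne'
  have h1 := J.cn_add hκ x y
  have h2 := J.dn_add hκ x y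
  refine mul_right_cancel₀ h ?_
  linear_combination -h2 - κ ^ 2 * J.sn x * J.sn y * h1

theorem dn_eq_of_sn_sq_eq {u v : ℝ} (h : J.sn u ^ 2 = J.sn v ^ 2) : J.dn u = J.dn v := by
  refine (pow_left_inj₀ (J.dn_pos u).le (J.dn_pos v).le two_ne_zero).1 ?_
  rw [J.dn_sq, J.dn_sq, h]

/-- Parity comes from the addition formulas at $x$ and $-x$. The first forces
$\mathrm{sn}^2x=\mathrm{sn}^2(-x)$; of the four sign choices, the wrong ones contradict the second,
whose left-hand side is a positive denominator, unless a vanishing value makes them harmless. -/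
theorem sn_cn_neg (hκ : κ ^ 2 < 1) (x : ℝ) : J.sn (-x) = -J.sn x ∧ J.cn (-x) = J.cn x := by
  have hD := J.denom_pos hκ x (-x)
  have h1 := J.sn_add hκ x (-x)
  have h2 := J.cn_add hκ x (-x)
  rw [add_neg_cancel, J.sn_zero] at h1
  rw [add_neg_cancel, J.cn_zero] at h2
  have hs : J.sn x ^ 2 = J.sn (-x) ^ 2 := by
    have h3 := J.cn_sq x
    have h4 := J.dn_sq x
    have h5 := J.cn_sq (-x)
    have h6 := J.dn_sq (-x)
    have : (J.sn x ^ 2 - J.sn (-x) ^ 2) * (1 - κ ^ 2 * J.sn x ^ 2 * J.sn (-x) ^ 2) = 0 := by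
      linear_combination (J.sn (-x) * (J.cn x * J.dn x) - J.sn x * (J.cn (-x) * J.dn (-x))) * h1
        - J.sn x ^ 2 * J.dn (-x) ^ 2 * h5 - J.sn x ^ 2 * (1 - J.sn (-x) ^ 2) * h6
        + J.sn (-x) ^ 2 * J.dn x ^ 2 * h3 + J.sn (-x) ^ 2 * (1 - J.sn x ^ 2) * h4
    linarith [(mul_eq_zero.1 this).resolve_right hD.ne']
  have hd := J.dn_eq_of_sn_sq_eq hs
  have hc : J.cn x ^ 2 = J.cn (-x) ^ 2 := by rw [J.cn_sq, J.cn_sq, hs]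
  have hp := J.dn_pos x
  rw [← hd] at h1 h2
  rcases sq_eq_sq_iff_eq_or_eq_neg.1 hs with hs' | hs' <;>
    rcases sq_eq_sq_iff_eq_or_eq_neg.1 hc with hc' | hc'
  · rw [← hs', ← hc'] at h1
    have h0 : (J.dn x * J.cn x) * J.sn x = 0 := by linarith
    rw [← hs', ← hc'] at h2 ⊢
    refine ⟨?_, rfl⟩
    rcases mul_eq_zero.1 h0 with h | h
    · have h3 := (mul_eq_zero.1 h).resolve_left hp.ne'
      rw [← hs'] at hD
      rw [h3] at h2
      nlinarith [sq_nonneg (J.sn x * J.dn x)]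
    · rw [h]; simp
  · have e : J.cn (-x) = -J.cn x := by linarith
    rw [← hs', e] at h2
    rw [← hs'] at hD
    nlinarith [sq_nonneg (J.sn x * J.dn x), sq_nonneg (J.cn x)]
  · exact ⟨by linarith, hc'.symm⟩
  · have e : J.cn (-x) = -J.cn x := by linarith
    have e' : J.sn (-x) = -J.sn x := by linarith
    rw [e, e'] at h1
    have h0 : (J.dn x * J.sn x) * J.cn x = 0 := by linarith
    refine ⟨e', ?_⟩
    rcases mul_eq_zero.1 h0 with h | h
    · have h3 := (mul_eq_zero.1 h).resolve_left hp.ne'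
      rw [e, e', h3] at h2
      nlinarith [sq_nonneg (J.cn x)]
    · rw [e, h]; simp

theorem sn_neg (hκ : κ ^ 2 < 1) (x : ℝ) : J.sn (-x) = -J.sn x := (J.sn_cn_neg hκ x).1

theorem cn_neg (hκ : κ ^ 2 < 1) (x : ℝ) : J.cn (-x) = J.cn x := (J.sn_cn_neg hκ x).2

theorem dn_neg (hκ : κ ^ 2 < 1) (x : ℝ) : J.dn (-x) = J.dn x :=
  J.dn_eq_of_sn_sq_eq (by rw [J.sn_neg hκ, neg_sq])

/-- The identity behind the incircles of Poncelet grids. -/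
theorem incircle_identity (hκ : κ ^ 2 < 1) (w a b : ℝ) :
    J.cn (w + (a + b)) * J.cn w * (J.dn a * J.dn b) +
      (1 - κ ^ 2) * (J.sn (w + (a + b)) * J.sn w) + (1 - κ ^ 2) * (J.sn a * J.sn b) =
    J.dn (w + (a + b)) * J.dn w * (J.cn a * J.cn b) := by
  -- The pairs $(a,b)$ and $(w+a+b,-w)$ have the same sum. After the product formulas, the identity
  -- is a multiple of the relation between $\mathrm{cn}^2(a+b)$ and $\mathrm{dn}^2(a+b)$.
  have h1 := J.cn_mul_cn hκ a b
  have h2 := J.dn_mul_dn hκ a b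
  have h3 := J.cn_mul_cn hκ (w + (a + b)) (-w)
  have h4 := J.dn_mul_dn hκ (w + (a + b)) (-w)
  have e : w + (a + b) + -w = a + b := by ring
  rw [e, J.cn_neg hκ, J.sn_neg hκ] at h3
  rw [e, J.dn_neg hκ, J.sn_neg hκ] at h4
  rw [h1, h2, h3, h4]
  have h5 := J.cn_sq (a + b)
  have h6 := J.dn_sq (a + b)
  linear_combination (J.sn a * J.sn b + J.sn (w + (a + b)) * J.sn w) * (κ ^ 2 * h5 - h6)

/-- `T` is a period of the Jacobi functions. -/
def IsPeriod (T : ℝ) : Prop := J.sn T = 0 ∧ J.cn T = 1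

variable {J}

theorem IsPeriod.dn_eq {T : ℝ} (h : J.IsPeriod T) : J.dn T = 1 := by
  rw [← J.dn_zero]; exact J.dn_eq_of_sn_sq_eq (by rw [h.1, J.sn_zero])

theorem IsPeriod.sn_add_eq (hκ : κ ^ 2 < 1) {T : ℝ} (h : J.IsPeriod T) (u : ℝ) :
    J.sn (u + T) = J.sn u := by
  have := J.sn_add hκ u T
  rw [h.1, h.2, h.dn_eq] at this
  linear_combination this

theorem IsPeriod.cn_add_eq (hκ : κ ^ 2 < 1) {T : ℝ} (h : J.IsPeriod T) (u : ℝ) :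
    J.cn (u + T) = J.cn u := by
  have := J.cn_add hκ u T
  rw [h.1, h.2, h.dn_eq] at this
  linear_combination this

theorem IsPeriod.neg (hκ : κ ^ 2 < 1) {T : ℝ} (h : J.IsPeriod T) : J.IsPeriod (-T) :=
  ⟨by rw [J.sn_neg hκ, h.1, neg_zero], by rw [J.cn_neg hκ, h.2]⟩

theorem IsPeriod.add (hκ : κ ^ 2 < 1) {T T' : ℝ} (h : J.IsPeriod T) (h' : J.IsPeriod T') :
    J.IsPeriod (T + T') :=
  ⟨by rw [h'.sn_add_eq hκ, h.1], by rw [h'.cn_add_eq hκ, h.2]⟩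

/-- A parameter is determined modulo periods by the unit normal of its tangent. -/
theorem isPeriod_sub_iff (hκ : κ ^ 2 < 1) {u v : ℝ} :
    J.IsPeriod (u - v) ↔ J.sn u = J.sn v ∧ J.cn u = J.cn v := by
  constructor
  · intro h
    have h1 := h.sn_add_eq hκ v
    have h2 := h.cn_add_eq hκ v
    rw [add_sub_cancel] at h1 h2
    exact ⟨h1, h2⟩
  · rintro ⟨hs, hc⟩
    have hd : J.dn u = J.dn v := J.dn_eq_of_sn_sq_eq (by rw [hs])
    have h1 := J.sn_add hκ u (-v)
    have h2 := J.cn_add hκ u (-v)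
    have hD := J.denom_pos hκ u (-v)
    rw [← sub_eq_add_neg, J.sn_neg hκ, J.cn_neg hκ, J.dn_neg hκ] at h1 h2
    rw [J.sn_neg hκ] at hD
    constructor
    · refine (mul_eq_zero.1 (h1.trans ?_)).resolve_right hD.ne'
      rw [hs, hc, hd]; ring
    · refine mul_right_cancel₀ hD.ne' (h2.trans ?_)
      rw [hs, hc, hd]
      linear_combination J.cn_sq v + J.sn v ^ 2 * J.dn_sq v

/-- Antipodal arguments differ by a half-period. -/
theorem isPeriod_two_mul_sub (hκ : κ ^ 2 < 1) {u v : ℝ} (hs : J.sn u = -J.sn v)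
    (hc : J.cn u = -J.cn v) : J.IsPeriod (2 * (u - v)) := by
  have hd : J.dn u = J.dn v := J.dn_eq_of_sn_sq_eq (by rw [hs, neg_sq])
  have h1 := J.sn_add hκ u (-v)
  have h2 := J.cn_add hκ u (-v)
  have hD := J.denom_pos hκ u (-v)
  rw [← sub_eq_add_neg, J.sn_neg hκ, J.cn_neg hκ, J.dn_neg hκ] at h1 h2
  rw [J.sn_neg hκ] at hD
  have hs0 : J.sn (u - v) = 0 := by
    refine (mul_eq_zero.1 (h1.trans ?_)).resolve_right hD.ne'
    rw [hs, hc, hd]; ring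
  have hc0 : J.cn (u - v) = -1 := by
    refine mul_right_cancel₀ hD.ne' (h2.trans ?_)
    rw [hs, hc, hd]
    linear_combination -J.cn_sq v - J.sn v ^ 2 * J.dn_sq v
  have h3 := J.sn_add hκ (u - v) (u - v)
  have h4 := J.cn_add hκ (u - v) (u - v)
  rw [hs0, ← two_mul] at h3 h4
  rw [hc0] at h4
  exact ⟨by linarith, by linarith⟩

theorem isPeriod_two_mul_of_sn_eq_zero (hκ : κ ^ 2 < 1) {u : ℝ} (h : J.sn u = 0) :
    J.IsPeriod (2 * u) := by
  have h1 := J.cn_sq u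
  rw [h] at h1
  have h3 := J.sn_add hκ u u
  have h4 := J.cn_add hκ u u
  rw [h, ← two_mul] at h3 h4
  exact ⟨by linarith, by linarith⟩

/-- Duplication gives $\mathrm{sn}\,2u=0$, so $2u$ is a half-period. -/
theorem isPeriod_four_mul_of_cn_eq_zero (hκ : κ ^ 2 < 1) {u : ℝ} (h : J.cn u = 0) :
    J.IsPeriod (2 * (2 * u)) := by
  refine isPeriod_two_mul_of_sn_eq_zero hκ ?_
  have h3 := J.sn_add hκ u u
  rw [h, ← two_mul] at h3
  refine (mul_eq_zero.1 (h3.trans (by ring))).resolve_right (J.denom_pos hκ u u).ne'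

/-- The square of `sn` sees its argument only up to sign and half-periods, so only the doubled
arguments can be compared. This suits half-differences of tangent parameters. -/
theorem isPeriod_of_sn_sq_eq (hκ : κ ^ 2 < 1) {u v : ℝ} (h : J.sn u ^ 2 = J.sn v ^ 2) :
    J.IsPeriod (2 * u - 2 * v) ∨ J.IsPeriod (2 * u + 2 * v) := by
  have hc : J.cn u ^ 2 = J.cn v ^ 2 := by rw [J.cn_sq, J.cn_sq, h]
  rcases sq_eq_sq_iff_eq_or_eq_neg.1 h with hs' | hs' <;>
    rcases sq_eq_sq_iff_eq_or_eq_neg.1 hc with hc' | hc'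
  · left
    have := (isPeriod_sub_iff hκ).2 ⟨hs', hc'⟩
    have h2 := this.add hκ this
    rwa [show u - v + (u - v) = 2 * u - 2 * v by ring] at h2
  · right
    have := isPeriod_two_mul_sub hκ (u := u) (v := -v) (by rw [J.sn_neg hκ, hs', neg_neg])
      (by rw [J.cn_neg hκ, hc'])
    rwa [show 2 * (u - -v) = 2 * u + 2 * v by ring] at this
  · right
    have := (isPeriod_sub_iff hκ (u := u) (v := -v)).2
      ⟨by rw [J.sn_neg hκ, hs'], by rw [J.cn_neg hκ, hc']⟩
    have h2 := this.add hκ this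
    rwa [show u - -v + (u - -v) = 2 * u + 2 * v by ring] at h2
  · left
    have := isPeriod_two_mul_sub hκ hs' hc'
    rwa [mul_sub] at this

end JacobiFunctions

end PonceletIncircle

end

/-! ### Coordinates, lines, sides and tangent circles in an orthonormal frame. -/

noncomputable section

namespace PonceletIncircle

open AffineSubspace

variable (b : OrthonormalBasis (Fin 2) ℝ Plane) (O : Plane)

/-- The first coordinate of `z` in the orthonormal frame `b` at `O`. -/
def xcoord (z : Plane) : ℝ := inner ℝ (b 0) (z - O)

/-- The second coordinate of `z` in the orthonormal frame `b` at `O`. -/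
def ycoord (z : Plane) : ℝ := inner ℝ (b 1) (z - O)

/-- The point with given coordinates in the orthonormal frame `b` at `O`. -/
def ofCoords (x y : ℝ) : Plane := O + (x • b 0 + y • b 1)

theorem inner_basis (i j : Fin 2) : inner ℝ (b i) (b j) = if i = j then (1 : ℝ) else 0 :=
  orthonormal_iff_ite.1 b.orthonormal i j

@[simp] theorem xcoord_ofCoords (x y : ℝ) : xcoord b O (ofCoords b O x y) = x := by
  simp [xcoord, ofCoords, inner_add_right, inner_smul_right]

@[simp] theorem ycoord_ofCoords (x y : ℝ) : ycoord b O (ofCoords b O x y) = y := by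
  simp [ycoord, ofCoords, inner_add_right, inner_smul_right]

theorem ofCoords_coords (z : Plane) : ofCoords b O (xcoord b O z) (ycoord b O z) = z := by
  have := b.sum_repr' (z - O)
  rw [Fin.sum_univ_two] at this
  rw [ofCoords, xcoord, ycoord, this, add_sub_cancel]

variable {b O} in
theorem ext_coords {z z' : Plane} (hx : xcoord b O z = xcoord b O z')
    (hy : ycoord b O z = ycoord b O z') : z = z' := by
  rw [← ofCoords_coords b O z, ← ofCoords_coords b O z', hx, hy]

theorem xcoord_sub (z z' : Plane) : inner ℝ (b 0) (z - z') = xcoord b O z - xcoord b O z' := by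
  rw [xcoord, xcoord, ← inner_sub_right, sub_sub_sub_cancel_right]

theorem ycoord_sub (z z' : Plane) : inner ℝ (b 1) (z - z') = ycoord b O z - ycoord b O z' := by
  rw [ycoord, ycoord, ← inner_sub_right, sub_sub_sub_cancel_right]

theorem xcoord_combine (c : ℝ) (p q r : Plane) : xcoord b O (c • (p - q) + r) =
    c * (xcoord b O p - xcoord b O q) + xcoord b O r := by
  rw [← xcoord_sub, xcoord, xcoord, ← inner_smul_right, ← inner_add_right, add_sub_assoc]

theorem ycoord_combine (c : ℝ) (p q r : Plane) : ycoord b O (c • (p - q) + r) =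
    c * (ycoord b O p - ycoord b O q) + ycoord b O r := by
  rw [← ycoord_sub, ycoord, ycoord, ← inner_smul_right, ← inner_add_right, add_sub_assoc]

theorem inner_coords (p q r s : Plane) : inner ℝ (p - q) (r - s) =
    (xcoord b O p - xcoord b O q) * (xcoord b O r - xcoord b O s) +
      (ycoord b O p - ycoord b O q) * (ycoord b O r - ycoord b O s) := by
  rw [← b.sum_inner_mul_inner, Fin.sum_univ_two, real_inner_comm, xcoord_sub b O, xcoord_sub b O,
    real_inner_comm, ycoord_sub b O, ycoord_sub b O]

theorem dist_sq_coords (p q : Plane) : dist p q ^ 2 =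
    (xcoord b O p - xcoord b O q) ^ 2 + (ycoord b O p - ycoord b O q) ^ 2 := by
  rw [dist_eq_norm, ← real_inner_self_eq_norm_sq, inner_coords b O]; ring

@[simp] theorem xcoord_self : xcoord b O O = 0 := by simp [xcoord]

@[simp] theorem ycoord_self : ycoord b O O = 0 := by simp [ycoord]

/-- The line with the equation `g₁ x + g₂ y = h`. -/
def planeLine (g₁ g₂ h : ℝ) : AffineSubspace ℝ Plane where
  carrier := {z | g₁ * xcoord b O z + g₂ * ycoord b O z = h}
  smul_vsub_vadd_mem' c p q r hp hq hr := by
    simp only [Set.mem_ofPred_eq] at hp hq hr ⊢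
    rw [vsub_eq_sub, vadd_eq_add, xcoord_combine, ycoord_combine]
    linear_combination c * hp - c * hq + hr

variable {b O}

theorem mem_planeLine {g₁ g₂ h : ℝ} {z : Plane} :
    z ∈ planeLine b O g₁ g₂ h ↔ g₁ * xcoord b O z + g₂ * ycoord b O z = h := Iff.rfl

/-- Scaling the equation of a line. -/
theorem planeLine_smul {c : ℝ} (hc : c ≠ 0) (g₁ g₂ h : ℝ) :
    planeLine b O (c * g₁) (c * g₂) (c * h) = planeLine b O g₁ g₂ h := by
  ext z
  rw [mem_planeLine, mem_planeLine, mul_assoc, mul_assoc, ← mul_add, mul_right_inj' hc]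

theorem planeLine_eq_span_pair {g₁ g₂ h : ℝ} (hg : g₁ ≠ 0 ∨ g₂ ≠ 0) {p q : Plane} (hpq : p ≠ q)
    (hp : p ∈ planeLine b O g₁ g₂ h) (hq : q ∈ planeLine b O g₁ g₂ h) :
    planeLine b O g₁ g₂ h = line[ℝ, p, q] := by
  refine le_antisymm (fun z hz => ?_) ?_
  · rw [mem_planeLine] at hp hq hz
    have hd : (xcoord b O q - xcoord b O p) ^ 2 + (ycoord b O q - ycoord b O p) ^ 2 ≠ 0 := by
      rw [← dist_sq_coords b O]
      exact pow_ne_zero _ (dist_ne_zero.2 hpq.symm)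
    suffices AffineMap.lineMap p q
        (((xcoord b O q - xcoord b O p) * (xcoord b O z - xcoord b O p) +
          (ycoord b O q - ycoord b O p) * (ycoord b O z - ycoord b O p)) /
        ((xcoord b O q - xcoord b O p) ^ 2 + (ycoord b O q - ycoord b O p) ^ 2)) = z from
      this ▸ AffineMap.lineMap_mem_affineSpan_pair _ p q
    rw [AffineMap.lineMap_apply, vsub_eq_sub, vadd_eq_add]
    generalize hx : xcoord b O q - xcoord b O p = x at *
    generalize hy : ycoord b O q - ycoord b O p = y at *
    generalize hx' : xcoord b O z - xcoord b O p = x' at *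
    generalize hy' : ycoord b O z - ycoord b O p = y' at *
    have h1 : g₁ * x + g₂ * y = 0 := by rw [← hx, ← hy]; linear_combination hq - hp
    have h2 : g₁ * x' + g₂ * y' = 0 := by rw [← hx', ← hy']; linear_combination hz - hp
    -- Both difference vectors are orthogonal to the same nonzero normal, hence parallel.
    have h3 : x * y' - y * x' = 0 := by
      rcases hg with hg | hg
      · refine (mul_eq_zero.1 ?_).resolve_left hg
        linear_combination y' * h1 - y * h2
      · refine (mul_eq_zero.1 ?_).resolve_left hg
        linear_combination x * h2 - x' * h1
    apply ext_coords (b := b) (O := O)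
    · rw [xcoord_combine, hx, div_mul_eq_mul_div, ← eq_sub_iff_add_eq, hx', div_eq_iff hd]
      linear_combination y * h3
    · rw [ycoord_combine, hy, div_mul_eq_mul_div, ← eq_sub_iff_add_eq, hy', div_eq_iff hd]
      linear_combination -x * h3
  · rw [affineSpan_le]
    rintro z (rfl | rfl)
    · exact hp
    · exact hq

theorem affineSpan_eq_planeLine {g₁ g₂ h : ℝ} (hg : g₁ ≠ 0 ∨ g₂ ≠ 0) {p q : Plane} (hpq : p ≠ q)
    {s : Set Plane} (hp : p ∈ s) (hq : q ∈ s) (hs : ∀ z ∈ s, z ∈ planeLine b O g₁ g₂ h) :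
    affineSpan ℝ s = planeLine b O g₁ g₂ h := by
  refine le_antisymm (affineSpan_le.2 hs) ?_
  rw [planeLine_eq_span_pair hg hpq (hs p hp) (hs q hq)]
  exact affineSpan_mono ℝ (Set.insert_subset hp (Set.singleton_subset_iff.2 hq))

theorem exists_planeLine_eq_span_pair {g₁ g₂ h : ℝ} (hg : g₁ ≠ 0 ∨ g₂ ≠ 0) :
    ∃ p q, p ≠ q ∧ planeLine b O g₁ g₂ h = line[ℝ, p, q] := by
  have hpos : 0 < g₁ ^ 2 + g₂ ^ 2 := by rcases hg with hg | hg <;> positivity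
  set p := ofCoords b O (h / (g₁ ^ 2 + g₂ ^ 2) * g₁) (h / (g₁ ^ 2 + g₂ ^ 2) * g₂) with hp
  set q := ofCoords b O (h / (g₁ ^ 2 + g₂ ^ 2) * g₁ - g₂) (h / (g₁ ^ 2 + g₂ ^ 2) * g₂ + g₁) with hq
  have hpq : p ≠ q := by
    intro he
    have h1 := congrArg (xcoord b O) he
    have h2 := congrArg (ycoord b O) he
    simp only [hp, hq, xcoord_ofCoords, ycoord_ofCoords] at h1 h2
    rcases hg with hg | hg <;> apply hg <;> linarith
  refine ⟨p, q, hpq, planeLine_eq_span_pair hg hpq ?_ ?_⟩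
  · rw [mem_planeLine, hp, xcoord_ofCoords, ycoord_ofCoords]; field_simp
  · rw [mem_planeLine, hq, xcoord_ofCoords, ycoord_ofCoords]; field_simp; ring

theorem finrank_direction_planeLine {g₁ g₂ h : ℝ} (hg : g₁ ≠ 0 ∨ g₂ ≠ 0) :
    Module.finrank ℝ (planeLine b O g₁ g₂ h).direction = 1 := by
  obtain ⟨p, q, hpq, he⟩ := exists_planeLine_eq_span_pair (b := b) (O := O) (h := h) hg
  rw [he, direction_affineSpan, vectorSpan_pair_rev]
  exact finrank_span_singleton (vsub_ne_zero.2 hpq.symm)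

theorem collinear_planeLine {g₁ g₂ h : ℝ} (hg : g₁ ≠ 0 ∨ g₂ ≠ 0) :
    Collinear ℝ (planeLine b O g₁ g₂ h : Set Plane) := by
  rw [collinear_iff_finrank_le_one, ← direction_eq_vectorSpan, finrank_direction_planeLine hg]

theorem planeLine_nonempty {g₁ g₂ h : ℝ} (hg : g₁ ≠ 0 ∨ g₂ ≠ 0) :
    (planeLine b O g₁ g₂ h : Set Plane).Nonempty := by
  obtain ⟨p, q, -, he⟩ := exists_planeLine_eq_span_pair (b := b) (O := O) (h := h) hg
  exact ⟨p, he ▸ left_mem_affineSpan_pair ℝ p q⟩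

section sides

variable {g₁ g₂ h : ℝ}

/-- The foot of the perpendicular dropped on a line. -/
theorem foot_mem_planeLine (hg : g₁ ^ 2 + g₂ ^ 2 = 1) (z : Plane) :
    z + (h - (g₁ * xcoord b O z + g₂ * ycoord b O z)) • (g₁ • b 0 + g₂ • b 1) ∈
      planeLine b O g₁ g₂ h := by
  have h1 : ∀ c : ℝ, z + c • (g₁ • b 0 + g₂ • b 1) = c • (ofCoords b O g₁ g₂ - O) + z := by
    intro c; simp [ofCoords, add_comm]
  rw [mem_planeLine, h1, xcoord_combine, ycoord_combine]
  simp only [xcoord_ofCoords, ycoord_ofCoords, xcoord_self, ycoord_self]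
  linear_combination (h - (g₁ * xcoord b O z + g₂ * ycoord b O z)) * hg

/-- The feet of the perpendiculars from $O$ and $z$ serve as witnesses: the vectors from the feet to
the points are nonnegative multiples of one normal. -/
theorem sSameSide_of_lt (hg : g₁ ^ 2 + g₂ ^ 2 = 1) (hh : 0 < h) {z : Plane}
    (hz : g₁ * xcoord b O z + g₂ * ycoord b O z < h) : (planeLine b O g₁ g₂ h).SSameSide O z := by
  refine ⟨⟨_, foot_mem_planeLine hg O, _, foot_mem_planeLine hg z, ?_⟩, ?_, ?_⟩
  · simp only [vsub_eq_sub, sub_add_cancel_left]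
    rw [← smul_neg, ← smul_neg]
    exact ((SameRay.refl _).nonneg_smul_left (by simpa using hh.le)).nonneg_smul_right
      (by linarith)
  · rw [mem_planeLine]; simp [hh.ne]
  · rw [mem_planeLine]; exact hz.ne

theorem sOppSide_of_lt (hg : g₁ ^ 2 + g₂ ^ 2 = 1) (hh : 0 < h) {z : Plane}
    (hz : h < g₁ * xcoord b O z + g₂ * ycoord b O z) : (planeLine b O g₁ g₂ h).SOppSide O z := by
  refine ⟨⟨_, foot_mem_planeLine hg O, _, foot_mem_planeLine hg z, ?_⟩, ?_, ?_⟩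
  · simp only [vsub_eq_sub, sub_add_cancel_left, add_sub_cancel_left]
    rw [← smul_neg, ← neg_smul_neg (h - (g₁ * xcoord b O z + g₂ * ycoord b O z))]
    exact ((SameRay.refl _).nonneg_smul_left (by simpa using hh.le)).nonneg_smul_right
      (by linarith)
  · rw [mem_planeLine]; simp [hh.ne]
  · rw [mem_planeLine]; exact hz.ne'

theorem sSameSide_iff (hg : g₁ ^ 2 + g₂ ^ 2 = 1) (hh : 0 < h) {z : Plane} :
    (planeLine b O g₁ g₂ h).SSameSide O z ↔ g₁ * xcoord b O z + g₂ * ycoord b O z < h := by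
  refine ⟨fun H => ?_, sSameSide_of_lt hg hh⟩
  by_contra hlt
  rcases (not_lt.1 hlt).eq_or_lt with he | he
  · exact H.right_notMem he.symm
  · exact H.not_sOppSide (sOppSide_of_lt hg hh he)

theorem sOppSide_iff (hg : g₁ ^ 2 + g₂ ^ 2 = 1) (hh : 0 < h) {z : Plane} :
    (planeLine b O g₁ g₂ h).SOppSide O z ↔ h < g₁ * xcoord b O z + g₂ * ycoord b O z := by
  refine ⟨fun H => ?_, sOppSide_of_lt hg hh⟩
  by_contra hlt
  rcases (not_lt.1 hlt).eq_or_lt with he | he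
  · exact H.right_notMem he
  · exact H.not_sSameSide (sSameSide_of_lt hg hh he)

theorem isTangent_planeLine_iff (hg : g₁ ^ 2 + g₂ ^ 2 = 1)
    {S : EuclideanGeometry.Sphere Plane} : S.IsTangent (planeLine b O g₁ g₂ h) ↔
      S.radius = |h - (g₁ * xcoord b O S.center + g₂ * ycoord b O S.center)| := by
  constructor
  · rintro ⟨p, hp⟩
    have h1 := EuclideanGeometry.mem_sphere.1 hp.mem_sphere
    have h2 := hp.mem_space
    -- Moving the point of contact along the line shows that the radius is orthogonal to the
    -- direction $(-g_2,g_1)$, hence parallel to the normal.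
    have h3 := hp.inner_left_eq_zero_of_mem
      (x := ofCoords b O (xcoord b O p - g₂) (ycoord b O p + g₁)) (by
        rw [mem_planeLine] at h2 ⊢
        rw [xcoord_ofCoords, ycoord_ofCoords]; linear_combination h2)
    rw [mem_planeLine] at h2
    rw [vsub_eq_sub, vsub_eq_sub, inner_coords b O, xcoord_ofCoords, ycoord_ofCoords] at h3
    have h4 := dist_sq_coords b O p S.center
    rw [← abs_of_nonneg (h1 ▸ dist_nonneg : 0 ≤ S.radius), ← sq_eq_sq_iff_abs_eq_abs, ← h1, h4,
      ← h2]
    set x := xcoord b O p - xcoord b O S.center with hx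
    set y := ycoord b O p - ycoord b O S.center with hy
    have h5 : g₁ * y = g₂ * x := by linear_combination h3
    have h6 : g₁ * xcoord b O p + g₂ * ycoord b O p -
      (g₁ * xcoord b O S.center + g₂ * ycoord b O S.center) = g₁ * x + g₂ * y := by
      rw [hx, hy]; ring
    rw [h6]
    linear_combination (-(x ^ 2 + y ^ 2)) * hg + (g₁ * y - g₂ * x) * h5
  · intro hr
    refine ⟨_, EuclideanGeometry.mem_sphere.2 ?_, foot_mem_planeLine hg S.center, ?_⟩
    · rw [dist_eq_norm, add_sub_cancel_left, norm_smul, hr, Real.norm_eq_abs]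
      have : ‖g₁ • b 0 + g₂ • b 1‖ = 1 := by
        have h1 : ‖g₁ • b 0 + g₂ • b 1‖ ^ 2 = 1 := by
          rw [← real_inner_self_eq_norm_sq]
          simp only [inner_add_left, inner_add_right, inner_smul_left, inner_smul_right,
            inner_basis]
          simp
          linarith
        nlinarith [norm_nonneg (g₁ • b 0 + g₂ • b 1)]
      rw [this, mul_one]
    · intro z hz
      have hf := foot_mem_planeLine (b := b) (O := O) (h := h) hg S.center
      rw [EuclideanGeometry.Sphere.mem_orthRadius_iff_inner_left]
      set f := S.center + (h - (g₁ * xcoord b O S.center + g₂ * ycoord b O S.center)) •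
        (g₁ • b 0 + g₂ • b 1) with hfd
      rw [mem_planeLine] at hz hf
      rw [vsub_eq_sub, vsub_eq_sub]
      have : f - S.center = (h - (g₁ * xcoord b O S.center + g₂ * ycoord b O S.center)) •
        (g₁ • b 0 + g₂ • b 1) := by rw [hfd, add_sub_cancel_left]
      rw [this, inner_smul_right, inner_add_right, inner_smul_right, inner_smul_right,
        real_inner_comm, xcoord_sub b O, real_inner_comm, ycoord_sub b O]
      rw [mul_eq_zero]; right; linear_combination hz - hf

end sides

end PonceletIncircle

end

/-! ### Confocal ellipses and the Jacobi form of their tangents. -/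

noncomputable section

namespace PonceletIncircle

open JacobiFunctions

theorem exists_frame (F₁ F₂ : Plane) : ∃ b : OrthonormalBasis (Fin 2) ℝ Plane,
    F₁ = ofCoords b (midpoint ℝ F₁ F₂) (-(dist F₁ F₂ / 2)) 0 ∧
    F₂ = ofCoords b (midpoint ℝ F₁ F₂) (dist F₁ F₂ / 2) 0 := by
  by_cases h : F₁ = F₂
  · subst h
    exact ⟨EuclideanSpace.basisFun _ _, by simp [ofCoords]⟩
  · have hd : dist F₁ F₂ ≠ 0 := dist_ne_zero.2 h
    set e : Plane := (dist F₁ F₂)⁻¹ • (F₂ - F₁) with he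
    have hn : ‖e‖ = 1 := by
      rw [he, norm_smul, norm_inv, ← dist_eq_norm, dist_comm F₂, Real.norm_eq_abs, abs_dist,
        inv_mul_cancel₀ hd]
    obtain ⟨b, hb⟩ := Orthonormal.exists_orthonormalBasis_extension_of_card_eq (𝕜 := ℝ)
      (E := Plane) (ι := Fin 2) (by simp) (v := fun _ => e) (s := {0})
      ⟨fun _ => hn, fun i j hij => (hij (Subsingleton.elim i j)).elim⟩
    have hb0 : b 0 = e := hb 0 rfl
    have h1 : (dist F₁ F₂ / 2) • b 0 = (1 / 2 : ℝ) • (F₂ - F₁) := by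
      rw [hb0, he, smul_smul]; congr 1; field_simp
    refine ⟨b, ?_, ?_⟩
    · rw [ofCoords, neg_smul, h1, midpoint_eq_smul_add]
      ext i; simp; ring
    · rw [ofCoords, h1, midpoint_eq_smul_add]
      ext i; simp; ring

variable {b : OrthonormalBasis (Fin 2) ℝ Plane} {O F₁ F₂ : Plane} {f s t : ℝ}

theorem mem_ellipse_iff (h1 : F₁ = ofCoords b O (-f) 0) (h2 : F₂ = ofCoords b O f 0)
    (hf : 0 ≤ f) (hs : f < s) {z : Plane} : z ∈ ellipse F₁ F₂ s ↔
      (s ^ 2 - f ^ 2) * xcoord b O z ^ 2 + s ^ 2 * ycoord b O z ^ 2 = s ^ 2 * (s ^ 2 - f ^ 2) := by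
  have hs0 : 0 < s := hf.trans_lt hs
  have d1 := dist_sq_coords b O z F₁
  have d2 := dist_sq_coords b O z F₂
  rw [h1, xcoord_ofCoords, ycoord_ofCoords, ← h1] at d1
  rw [h2, xcoord_ofCoords, ycoord_ofCoords, ← h2] at d2
  have p1 : 0 ≤ dist z F₁ := dist_nonneg
  have p2 : 0 ≤ dist z F₂ := dist_nonneg
  change dist z F₁ + dist z F₂ = 2 * s ↔ _
  generalize dist z F₁ = P at *
  generalize dist z F₂ = Q at *
  generalize xcoord b O z = x at *
  generalize ycoord b O z = y at *
  constructor
  · intro h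
    have h3 : s * (P - Q) = 2 * f * x := by
      linear_combination d1 / 2 - d2 / 2 - (P - Q) / 2 * h
    -- The focal distances on an ellipse are affine in the abscissa: $s\pm fx/s$. In the converse
    -- direction, $|x|\le s$ selects the nonnegative square roots.
    have h4 : s * P = s ^ 2 + f * x := by linear_combination h3 / 2 + s / 2 * h
    linear_combination -s ^ 2 * d1 + (s * P + s ^ 2 + f * x) * h4
  · intro h
    have hp : 0 < s ^ 2 - f ^ 2 := by nlinarith
    have hx : x ^ 2 ≤ s ^ 2 := by
      have : (s ^ 2 - f ^ 2) * x ^ 2 ≤ (s ^ 2 - f ^ 2) * s ^ 2 := by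
        nlinarith [mul_nonneg (sq_nonneg s) (sq_nonneg y)]
      exact le_of_mul_le_mul_left this hp
    have hx' := abs_le_of_sq_le_sq' hx hs0.le
    have e1 : s * P = s ^ 2 + f * x := by
      refine (pow_left_inj₀ (by positivity) (by nlinarith) two_ne_zero).1 ?_
      linear_combination s ^ 2 * d1 + h
    have e2 : s * Q = s ^ 2 - f * x := by
      refine (pow_left_inj₀ (by positivity) (by nlinarith) two_ne_zero).1 ?_
      linear_combination s ^ 2 * d2 + h
    refine mul_left_cancel₀ hs0.ne' ?_
    linear_combination e1 + e2

/-- A line meets an ellipse in at most two points. -/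
theorem eq_of_mem_ellipse_of_mem_line (h1 : F₁ = ofCoords b O (-f) 0)
    (h2 : F₂ = ofCoords b O f 0) (hf : 0 ≤ f) (ht : f < t) {g₁ g₂ h : ℝ}
    (hg : g₁ ^ 2 + g₂ ^ 2 = 1) {p q r : Plane} (hp : p ∈ ellipse F₁ F₂ t)
    (hq : q ∈ ellipse F₁ F₂ t) (hr : r ∈ ellipse F₁ F₂ t) (hp' : p ∈ planeLine b O g₁ g₂ h)
    (hq' : q ∈ planeLine b O g₁ g₂ h) (hr' : r ∈ planeLine b O g₁ g₂ h) (hpq : p ≠ q)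
    (hpr : p ≠ r) : q = r := by
  rw [mem_ellipse_iff h1 h2 hf ht] at hp hq hr
  rw [mem_planeLine] at hp' hq' hr'
  have hB : 0 < t ^ 2 - f ^ 2 := by nlinarith
  have ht0 : 0 < t ^ 2 := pow_pos (hf.trans_lt ht) 2
  set B := t ^ 2 - f ^ 2
  have coord : ∀ z : Plane, g₁ * xcoord b O z + g₂ * ycoord b O z = h →
      xcoord b O z = h * g₁ - g₂ * (g₁ * ycoord b O z - g₂ * xcoord b O z) ∧
      ycoord b O z = h * g₂ + g₁ * (g₁ * ycoord b O z - g₂ * xcoord b O z) := by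
    intro z hz
    constructor
    · linear_combination -xcoord b O z * hg + g₁ * hz
    · linear_combination -ycoord b O z * hg + g₂ * hz
  obtain ⟨px, py⟩ := coord p hp'
  obtain ⟨qx, qy⟩ := coord q hq'
  obtain ⟨rx, ry⟩ := coord r hr'
  set μ := g₁ * ycoord b O p - g₂ * xcoord b O p
  set ν := g₁ * ycoord b O q - g₂ * xcoord b O q
  set ξ := g₁ * ycoord b O r - g₂ * xcoord b O r
  have n1 : μ - ν ≠ 0 := fun h0 => hpq (ext_coords (b := b) (O := O)
    (by rw [px, qx, sub_eq_zero.1 h0]) (by rw [py, qy, sub_eq_zero.1 h0]))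
  have n2 : μ - ξ ≠ 0 := fun h0 => hpr (ext_coords (b := b) (O := O)
    (by rw [px, rx, sub_eq_zero.1 h0]) (by rw [py, ry, sub_eq_zero.1 h0]))
  -- On the line, with arc length as parameter, the ellipse becomes a quadratic equation. Vieta
  -- gives the sum of two distinct roots, so $\nu$ and $\xi$ are both determined by $\mu$.
  have e1 : (B * g₂ ^ 2 + t ^ 2 * g₁ ^ 2) * (μ + ν) + 2 * (t ^ 2 - B) * (h * g₁ * g₂) = 0 := by
    rw [px, py] at hp
    rw [qx, qy] at hq
    refine (mul_eq_zero.1 ?_).resolve_left n1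
    linear_combination hp - hq
  have e2 : (B * g₂ ^ 2 + t ^ 2 * g₁ ^ 2) * (μ + ξ) + 2 * (t ^ 2 - B) * (h * g₁ * g₂) = 0 := by
    rw [px, py] at hp
    rw [rx, ry] at hr
    refine (mul_eq_zero.1 ?_).resolve_left n2
    linear_combination hp - hr
  have ha : 0 < B * g₂ ^ 2 + t ^ 2 * g₁ ^ 2 := by
    by_cases h0 : g₁ = 0
    · have : g₂ ^ 2 = 1 := by rw [h0] at hg; linarith
      rw [this, h0]; nlinarith
    · have : 0 < g₁ ^ 2 := by positivity
      nlinarith [mul_pos ht0 this, mul_nonneg hB.le (sq_nonneg g₂)]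
  have e3 : ν = ξ := by
    have : (B * g₂ ^ 2 + t ^ 2 * g₁ ^ 2) * (ν - ξ) = 0 := by linear_combination e1 - e2
    linarith [(mul_eq_zero.1 this).resolve_left ha.ne']
  exact ext_coords (b := b) (O := O) (by rw [qx, rx, e3]) (by rw [qy, ry, e3])

/-- The normal form of the tangents of an ellipse. -/
theorem exists_normal_form_of_isTangent (h1 : F₁ = ofCoords b O (-f) 0)
    (h2 : F₂ = ofCoords b O f 0) (hf : 0 ≤ f) (hs : f < s) {p q : Plane} (hpq : p ≠ q)
    (htan : IsTangentToEllipse (ellipse F₁ F₂ s) line[ℝ, p, q]) :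
    ∃ g₁ g₂ h : ℝ, g₁ ^ 2 + g₂ ^ 2 = 1 ∧ 0 < h ∧ h ^ 2 = s ^ 2 * g₁ ^ 2 + (s ^ 2 - f ^ 2) * g₂ ^ 2 ∧
      line[ℝ, p, q] = planeLine b O g₁ g₂ h := by
  have hB : 0 < s ^ 2 - f ^ 2 := by nlinarith
  have hs0 : 0 < s ^ 2 := pow_pos (hf.trans_lt hs) 2
  obtain ⟨z, ⟨hzl, hzE⟩, huniq⟩ := htan
  set dx := xcoord b O q - xcoord b O p with hdx
  set dy := ycoord b O q - ycoord b O p with hdy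
  have hd : 0 < dx ^ 2 + dy ^ 2 := by
    rw [← dist_sq_coords]; exact pow_pos (dist_pos.2 hpq.symm) 2
  have hne : dy ≠ 0 ∨ -dx ≠ 0 := by
    by_contra! hc
    rw [hc.1, neg_eq_zero.1 hc.2] at hd
    norm_num at hd
  have hline : planeLine b O dy (-dx) (dy * xcoord b O z + -dx * ycoord b O z) =
      line[ℝ, p, q] := by
    have h3 := planeLine_eq_span_pair (b := b) (O := O) (g₁ := dy) (g₂ := -dx)
      (h := dy * xcoord b O p + -dx * ycoord b O p) hne hpq
      (mem_planeLine.2 rfl) (mem_planeLine.2 (by rw [hdx, hdy]; ring))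
    rw [← h3] at hzl ⊢
    rw [mem_planeLine.1 hzl]
  rw [mem_ellipse_iff h1 h2 hf hs] at hzE
  set B := s ^ 2 - f ^ 2
  set x := xcoord b O z
  set y := ycoord b O z
  have ha : 0 < B * dx ^ 2 + s ^ 2 * dy ^ 2 := by
    rcases hne with h0 | h0
    · have : 0 < dy ^ 2 := by positivity
      nlinarith [mul_pos hs0 this, mul_nonneg hB.le (sq_nonneg dx)]
    · have : 0 < dx ^ 2 := by rw [← neg_sq]; positivity
      nlinarith [mul_pos hB this, mul_nonneg hs0.le (sq_nonneg dy)]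
  have hb0 : B * x * dx + s ^ 2 * y * dy = 0 := by
    -- This is the parameter of the second intersection with the ellipse. Tangency forces $r=0$,
    -- which says that the direction is conjugate to the point of contact.
    set r := -2 * (B * x * dx + s ^ 2 * y * dy) / (B * dx ^ 2 + s ^ 2 * dy ^ 2) with hr
    have hr' : r * (B * dx ^ 2 + s ^ 2 * dy ^ 2) = -2 * (B * x * dx + s ^ 2 * y * dy) := by
      rw [hr, div_mul_cancel₀ _ ha.ne']
    have := huniq (ofCoords b O (x + r * dx) (y + r * dy)) ⟨by
      rw [← hline, mem_planeLine, xcoord_ofCoords, ycoord_ofCoords]; ring, by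
      rw [mem_ellipse_iff h1 h2 hf hs, xcoord_ofCoords, ycoord_ofCoords]
      linear_combination hzE + r * hr'⟩
    have e1 := congrArg (xcoord b O) this
    have e2 := congrArg (ycoord b O) this
    rw [xcoord_ofCoords] at e1
    rw [ycoord_ofCoords] at e2
    have e3 : r * dx = 0 := by linarith
    have e4 : r * dy = 0 := by linarith
    have : r = 0 := by
      rcases hne with h0 | h0
      · exact (mul_eq_zero.1 e4).resolve_right h0
      · exact (mul_eq_zero.1 e3).resolve_right (neg_ne_zero.1 h0)
    rw [this] at hr'
    linarith
  have hk : (dy * x + -dx * y) ^ 2 = B * dx ^ 2 + s ^ 2 * dy ^ 2 := by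
    refine mul_left_cancel₀ (mul_pos hs0 hB).ne' ?_
    linear_combination (B * dx ^ 2 + s ^ 2 * dy ^ 2) * hzE -
      (B * x * dx + s ^ 2 * y * dy) * hb0
  rw [← hline]
  set k := dy * x + -dx * y
  have hk0 : k ≠ 0 := by
    intro h0; rw [h0] at hk; norm_num at hk; exact ha.ne hk
  -- The factor normalises the normal; its sign makes $O$ lie on the side where the equation is
  -- below its constant.
  obtain ⟨c, hc, hck⟩ : ∃ c : ℝ, c ^ 2 * (dx ^ 2 + dy ^ 2) = 1 ∧ 0 < c * k := by
    have hL : 0 < √(dx ^ 2 + dy ^ 2) := Real.sqrt_pos.2 hd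
    have hL2 := Real.sq_sqrt hd.le
    rcases lt_or_gt_of_ne hk0 with h0 | h0
    · refine ⟨-(√(dx ^ 2 + dy ^ 2))⁻¹, by rw [neg_sq, inv_pow, hL2, inv_mul_cancel₀ hd.ne'], ?_⟩
      have := inv_pos.2 hL
      nlinarith
    · exact ⟨(√(dx ^ 2 + dy ^ 2))⁻¹, by rw [inv_pow, hL2, inv_mul_cancel₀ hd.ne'],
        mul_pos (inv_pos.2 hL) h0⟩
  have hc0 : c ≠ 0 := by rintro rfl; norm_num at hc
  refine ⟨c * dy, c * -dx, c * k, by linear_combination hc, hck, ?_, (planeLine_smul hc0 _ _ _).symm⟩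
  linear_combination c ^ 2 * hk

/-- When the modulus is the eccentricity, $h^2=s^2g_1^2+(s^2-f^2)g_2^2$ becomes
$h^2=s^2\,\mathrm{dn}^2u$, and both roots are positive. -/
theorem exists_jacobi_tangent {κ : ℝ} (J : JacobiFunctions κ) (h1 : F₁ = ofCoords b O (-f) 0)
    (h2 : F₂ = ofCoords b O f 0) (hf : 0 ≤ f) (hs : f < s) (hκ : κ * s = f) {p q : Plane}
    (hpq : p ≠ q) (htan : IsTangentToEllipse (ellipse F₁ F₂ s) line[ℝ, p, q]) :
    ∃ u, line[ℝ, p, q] = planeLine b O (J.cn u) (J.sn u) (s * J.dn u) := by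
  obtain ⟨g₁, g₂, h, hg, hh, hh2, hl⟩ := exists_normal_form_of_isTangent h1 h2 hf hs hpq htan
  obtain ⟨u, hc, hs'⟩ := J.exists_eq g₁ g₂ hg
  refine ⟨u, ?_⟩
  have hs0 : 0 < s := hf.trans_lt hs
  have : s * J.dn u = h := by
    refine (pow_left_inj₀ (mul_pos hs0 (J.dn_pos u)).le hh.le two_ne_zero).1 ?_
    rw [hh2, mul_pow, J.dn_sq, hs', ← hκ]
    linear_combination s ^ 2 * (-hg)
  rw [hl, hc, hs', this]

end PonceletIncircle

end

/-! ### The sides of a Poncelet polygon as an arithmetic progression of parameters. -/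

noncomputable section

namespace PonceletIncircle

open JacobiFunctions

variable {κ : ℝ} {J : JacobiFunctions κ}

theorem JacobiFunctions.IsPeriod.sub (hκ : κ ^ 2 < 1) {T T' : ℝ} (h : J.IsPeriod T)
    (h' : J.IsPeriod T') : J.IsPeriod (T - T') := by
  rw [sub_eq_add_neg]; exact h.add hκ (h'.neg hκ)

theorem JacobiFunctions.isPeriod_zero : J.IsPeriod 0 := ⟨J.sn_zero, J.cn_zero⟩

/-- The intersection of two tangents of an ellipse. -/
theorem tangents_inter (hκ : κ ^ 2 < 1) {A : ℝ} (hA : 0 < A) {w x X Y : ℝ}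
    (hne : ¬ J.IsPeriod (2 * x))
    (h1 : J.cn (w + x) * X + J.sn (w + x) * Y = A * J.dn (w + x))
    (h2 : J.cn (w - x) * X + J.sn (w - x) * Y = A * J.dn (w - x)) :
    J.dn w * J.cn x * X = A * (J.cn w * J.dn x) ∧
      J.dn w * J.cn x * Y = A * ((1 - κ ^ 2) * J.sn w) := by
  -- For $b=0$ the incircle degenerates to a point: the identity says that the claimed intersection
  -- lies on both tangents. The rest is Cramer's rule.
  have i1 := J.incircle_identity hκ w x 0
  have i2 := J.incircle_identity hκ w (-x) 0
  rw [J.sn_zero, J.cn_zero, J.dn_zero, add_zero] at i1 i2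
  rw [← sub_eq_add_neg, J.cn_neg hκ, J.dn_neg hκ] at i2
  -- Dependent unit normals are equal or opposite. Equal ones make $2x$ a period; opposite ones
  -- contradict the positivity of both constants $A\,\mathrm{dn}$.
  have hdet : J.cn (w + x) * J.sn (w - x) - J.sn (w + x) * J.cn (w - x) ≠ 0 := by
    intro h0
    have c1 := J.cn_sq (w + x)
    have c2 := J.cn_sq (w - x)
    have hs : J.sn (w + x) ^ 2 = J.sn (w - x) ^ 2 := by
      linear_combination -(J.cn (w + x) * J.sn (w - x) + J.sn (w + x) * J.cn (w - x)) * h0 -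
        J.sn (w + x) ^ 2 * c2 + J.sn (w - x) ^ 2 * c1
    have hd := J.dn_eq_of_sn_sq_eq hs
    have hp := mul_pos hA (J.dn_pos (w - x))
    rcases sq_eq_sq_iff_eq_or_eq_neg.1 hs with e | e
    · have e' : J.cn (w + x) = J.cn (w - x) := by
        by_cases hz : J.sn (w - x) = 0
        · rw [hz] at e c2
          rw [e] at c1
          rcases sq_eq_sq_iff_eq_or_eq_neg.1 (c1.trans c2.symm) with h | h
          · exact h
          · rw [h, e, hd] at h1; rw [hz] at h2; linarith
        · refine mul_right_cancel₀ hz ?_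
          rw [e] at h0; linarith
      have := (isPeriod_sub_iff hκ).2 ⟨e, e'⟩
      exact hne (by rwa [show w + x - (w - x) = 2 * x by ring] at this)
    · have e' : J.cn (w + x) = -J.cn (w - x) := by
        by_cases hz : J.sn (w - x) = 0
        · rw [hz] at e c2
          rw [e] at c1
          rcases sq_eq_sq_iff_eq_or_eq_neg.1 (c1.trans (by rw [neg_zero]; exact c2.symm)) with h | h
          · have := (isPeriod_sub_iff hκ).2 ⟨by rw [e, hz, neg_zero], h⟩
            exact (hne (by rwa [show w + x - (w - x) = 2 * x by ring] at this)).elim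
          · exact h
        · refine mul_right_cancel₀ hz ?_
          rw [e] at h0; linarith
      rw [e, e', hd] at h1
      linarith
  constructor
  · refine mul_left_cancel₀ hdet ?_
    linear_combination (J.dn w * J.cn x) * (J.sn (w - x) * h1 - J.sn (w + x) * h2) -
      A * (J.sn (w - x) * i1 - J.sn (w + x) * i2)
  · refine mul_left_cancel₀ hdet ?_
    linear_combination (J.dn w * J.cn x) * (J.cn (w + x) * h2 - J.cn (w - x) * h1) -
      A * (J.cn (w + x) * i2 - J.cn (w - x) * i1)

/-- Tangents of an ellipse meeting on a confocal ellipse have constant parameter difference. -/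
theorem sn_sq_of_tangents_inter (hκ : κ ^ 2 < 1) {A f t : ℝ} (hA : 0 < A) (hf : κ * A = f)
    (hft : f ^ 2 < t ^ 2) {w x X Y : ℝ} (hne : ¬ J.IsPeriod (2 * x))
    (h1 : J.cn (w + x) * X + J.sn (w + x) * Y = A * J.dn (w + x))
    (h2 : J.cn (w - x) * X + J.sn (w - x) * Y = A * J.dn (w - x))
    (hE : (t ^ 2 - f ^ 2) * X ^ 2 + t ^ 2 * Y ^ 2 = t ^ 2 * (t ^ 2 - f ^ 2)) :
    J.sn x ^ 2 = (t ^ 2 - A ^ 2) / (t ^ 2 - f ^ 2) := by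
  obtain ⟨hX, hY⟩ := tangents_inter hκ hA hne h1 h2
  have hB : 0 < t ^ 2 - f ^ 2 := by linarith
  have ht : 0 < t ^ 2 := by nlinarith [sq_nonneg f]
  have c1 := J.cn_sq w
  have c2 := J.cn_sq x
  have d1 := J.dn_sq w
  have d2 := J.dn_sq x
  have e1 : (t ^ 2 - f ^ 2) * (A ^ 2 * ((1 - J.sn w ^ 2) * (1 - κ ^ 2 * J.sn x ^ 2))) +
      t ^ 2 * (A ^ 2 * ((1 - κ ^ 2) ^ 2 * J.sn w ^ 2)) =
      t ^ 2 * (t ^ 2 - f ^ 2) * ((1 - κ ^ 2 * J.sn w ^ 2) * (1 - J.sn x ^ 2)) := by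
    rw [← c1, ← c2, ← d1, ← d2]
    linear_combination (J.dn w * J.cn x) ^ 2 * hE -
      (t ^ 2 - f ^ 2) * (J.dn w * J.cn x * X + A * (J.cn w * J.dn x)) * hX -
      t ^ 2 * (J.dn w * J.cn x * Y + A * ((1 - κ ^ 2) * J.sn w)) * hY
  -- The equation of the outer ellipse splits off a positive factor that contains all of $w$; the
  -- remaining factor involves $x$ only.
  have e2 : (A ^ 2 * (1 - κ ^ 2 * J.sn x ^ 2) - t ^ 2 * (1 - J.sn x ^ 2)) *
      ((t ^ 2 - f ^ 2) * (1 - J.sn w ^ 2) + t ^ 2 * (1 - κ ^ 2) * J.sn w ^ 2) = 0 := by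
    subst hf
    linear_combination e1
  have hpos : 0 < (t ^ 2 - f ^ 2) * (1 - J.sn w ^ 2) + t ^ 2 * (1 - κ ^ 2) * J.sn w ^ 2 := by
    have hk : 0 < t ^ 2 * (1 - κ ^ 2) := mul_pos ht (by linarith)
    rw [← c1]
    rcases eq_or_ne (J.sn w) 0 with h0 | h0
    · rw [h0] at c1 ⊢; rw [c1]; linarith
    · have : 0 < J.sn w ^ 2 := by positivity
      nlinarith [mul_pos hk this, mul_nonneg hB.le (sq_nonneg (J.cn w))]
  have e3 := (mul_eq_zero.1 e2).resolve_right hpos.ne'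
  rw [eq_div_iff hB.ne', ← hf]
  linear_combination e3

/-- The sides of a polygon parametrised by an arithmetic progression of arguments of
Jacobi functions. -/
structure IsJacobiProgression {m : ℕ} (J : JacobiFunctions κ)
    (b : OrthonormalBasis (Fin 2) ℝ Plane) (O : Plane) (A u τ : ℝ)
    (L : ZMod m → AffineSubspace ℝ Plane) : Prop where
  isPeriod_iff : ∀ j : ℤ, J.IsPeriod (j * τ) ↔ (j : ZMod m) = 0
  line_eq : ∀ j : ℤ, L j = planeLine b O (J.cn (u + j * τ)) (J.sn (u + j * τ))
    (A * J.dn (u + j * τ))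

theorem two_ne_zero_zmod {m : ℕ} (hm : 3 ≤ m) : (2 : ZMod m) ≠ 0 := by
  intro h
  have : ((2 : ℕ) : ZMod m) = 0 := by exact_mod_cast h
  rw [ZMod.natCast_eq_zero_iff] at this
  have := Nat.le_of_dvd two_pos this
  omega

theorem exists_isJacobiProgression (hκ : κ ^ 2 < 1) {b : OrthonormalBasis (Fin 2) ℝ Plane}
    {O F₁ F₂ : Plane} {f s t : ℝ} (h1 : F₁ = ofCoords b O (-f) 0)
    (h2 : F₂ = ofCoords b O f 0) (hf : 0 ≤ f) (hs : f < s) (hst : s < t) (hκs : κ * s = f)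
    {m : ℕ} (hm : 3 ≤ m) {p : ZMod m → Plane}
    (hp : IsPonceletPolygon (ellipse F₁ F₂ t) (ellipse F₁ F₂ s) p) :
    ∃ u τ, IsJacobiProgression J b O s u τ (side p) := by
  have : NeZero m := ⟨by omega⟩
  have : Fact (1 < m) := ⟨by omega⟩
  have h2m := two_ne_zero_zmod hm
  have hs0 : 0 < s := hf.trans_lt hs
  have hne : ∀ i : ZMod m, p i ≠ p (i + 1) := fun i h => by
    have := hp.injective h
    simp at this
  choose v hv using fun i => exists_jacobi_tangent J h1 h2 hf hs hκs (hne i) (hp.circumscribed i)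
  have hv' : ∀ i, side p i = planeLine b O (J.cn (v i)) (J.sn (v i)) (s * J.dn (v i)) := hv
  have mem0 : ∀ i, p i ∈ side p i := fun i => left_mem_affineSpan_pair ℝ _ _
  have mem1 : ∀ i, p (i + 1) ∈ side p i := fun i => right_mem_affineSpan_pair ℝ _ _
  -- A side meets the outer ellipse in its two vertices only, so equal sides share both; reversed
  -- order would give $2=0$ modulo $m$.
  have hinj : ∀ i j, side p i = side p j → i = j := by
    intro i j hij
    have key : ∀ k, p k ∈ side p i → k = i ∨ k = i + 1 := by
      intro k hk
      by_contra! hc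
      rw [hv'] at hk
      refine hc.2 (hp.injective ?_).symm
      exact eq_of_mem_ellipse_of_mem_line h1 h2 hf (hs.trans hst)
        (by rw [J.cn_sq]; ring) (hp.inscribed i) (hp.inscribed (i + 1)) (hp.inscribed k)
        (hv' i ▸ mem0 i) (hv' i ▸ mem1 i) hk (hne i) (fun h => hc.1 (hp.injective h).symm)
    rcases key j (hij ▸ mem0 j) with h | h
    · exact h.symm
    · rcases key (j + 1) (hij ▸ mem1 j) with h' | h'
      · rw [h] at h'
        exact (h2m (by linear_combination h')).elim
      · exact (add_right_cancel h').symm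
  have hline : ∀ {x y : ℝ}, J.IsPeriod (x - y) →
      planeLine b O (J.cn x) (J.sn x) (s * J.dn x) =
        planeLine b O (J.cn y) (J.sn y) (s * J.dn y) := by
    intro x y h
    obtain ⟨hsn, hcn⟩ := (isPeriod_sub_iff hκ).1 h
    rw [J.dn_eq_of_sn_sq_eq (congrArg (· ^ 2) hsn), hsn, hcn]
  have hper : ∀ i j, J.IsPeriod (v i - v j) → i = j := fun i j h =>
    hinj i j (by rw [hv', hv', hline h])
  have hσ : ∀ i, J.sn ((v (i + 1) - v i) / 2) ^ 2 = (t ^ 2 - s ^ 2) / (t ^ 2 - f ^ 2) := by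
    intro i
    have m1 : p (i + 1) ∈ side p i := mem1 i
    have m2 : p (i + 1) ∈ side p (i + 1) := mem0 _
    rw [hv', mem_planeLine] at m1 m2
    have hE := (mem_ellipse_iff h1 h2 hf (hs.trans hst)).1 (hp.inscribed (i + 1))
    refine sn_sq_of_tangents_inter hκ hs0 hκs (by nlinarith)
      (w := (v (i + 1) + v i) / 2) ?_ ?_ ?_ hE
    · intro h
      rw [mul_div_cancel₀ _ two_ne_zero] at h
      have := hper _ _ h
      simp at this
    · rw [show (v (i + 1) + v i) / 2 + (v (i + 1) - v i) / 2 = v (i + 1) by ring]; exact m2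
    · rw [show (v (i + 1) + v i) / 2 - (v (i + 1) - v i) / 2 = v i by ring]; exact m1
  -- The parameters `v i` are arbitrary choices, so the progression can hold only modulo periods.
  set τ := v 1 - v 0 with hτ
  have hstep : ∀ n : ℕ, J.IsPeriod (v ((n : ZMod m) + 1) - v n - τ) := by
    intro n
    induction n with
    | zero =>
      have : v (((0 : ℕ) : ZMod m) + 1) - v (0 : ℕ) - τ = 0 := by simp [hτ]
      rw [this]; exact isPeriod_zero
    | succ n ih =>
      have e1 := hσ ((n + 1 : ℕ) : ZMod m)
      have e2 := hσ 0
      rw [zero_add] at e2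
      rcases isPeriod_of_sn_sq_eq hκ (e1.trans e2.symm) with h | h
      · rwa [mul_div_cancel₀ _ two_ne_zero, mul_div_cancel₀ _ two_ne_zero] at h
      -- A step $-\tau$ after a step $\tau$ would return to the side before the last, and sides $n$
      -- and $n+2$ are distinct.
      · rw [mul_div_cancel₀ _ two_ne_zero, mul_div_cancel₀ _ two_ne_zero] at h
        have h3 := h.add hκ ih
        push_cast at h3
        have h4 := hper ((n : ZMod m) + 1 + 1) n (by
          rwa [show v ((n : ZMod m) + 1 + 1) - v ((n : ZMod m) + 1) + (v 1 - v 0) +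
            (v ((n : ZMod m) + 1) - v n - τ) = v ((n : ZMod m) + 1 + 1) - v n by
              rw [hτ]; ring] at h3)
        exact (h2m (by linear_combination h4)).elim
  have hstep' : ∀ i : ZMod m, J.IsPeriod (v (i + 1) - v i - τ) := by
    intro i
    have := hstep i.val
    rwa [ZMod.natCast_zmod_val] at this
  have hprog : ∀ j : ℤ, J.IsPeriod (v (j : ZMod m) - (v 0 + j * τ)) := by
    intro j
    induction j using Int.induction_on with
    | zero => simpa using isPeriod_zero
    | succ n ih =>
      have := ih.add hκ (hstep' ((n : ℤ) : ZMod m))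
      push_cast at this ⊢
      rwa [show v (n : ZMod m) - (v 0 + n * τ) + (v ((n : ZMod m) + 1) - v n - τ) =
        v ((n : ZMod m) + 1) - (v 0 + (n + 1) * τ) by ring] at this
    | pred n ih =>
      have := ih.sub hκ (hstep' ((-n - 1 : ℤ) : ZMod m))
      push_cast at this ⊢
      rw [sub_add_cancel] at this
      rwa [show v (-(n : ZMod m)) - (v 0 + -(n : ℝ) * τ) -
        (v (-(n : ZMod m)) - v (-(n : ZMod m) - 1) - τ) =
        v (-(n : ZMod m) - 1) - (v 0 + (-(n : ℝ) - 1) * τ) by ring] at this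
  refine ⟨v 0, τ, ⟨fun j => ⟨fun h => ?_, fun h => ?_⟩, fun j => ?_⟩⟩
  · refine hper _ _ ?_
    have := (hprog j).add hκ h
    rwa [show v (j : ZMod m) - (v 0 + j * τ) + j * τ = v (j : ZMod m) - v 0 by ring] at this
  · have := (hprog j).neg hκ
    rwa [h, show -(v 0 - (v 0 + j * τ)) = j * τ by ring] at this
  · rw [hv', hline (hprog j)]

end PonceletIncircle

end

/-! ### Signed distances, uniqueness of incircles and the grid points. -/

noncomputable section

namespace PonceletIncircle

open JacobiFunctions

variable {κ : ℝ} (J : JacobiFunctions κ) (b : OrthonormalBasis (Fin 2) ℝ Plane) (O : Plane) (A : ℝ)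

/-- The tangent of the ellipse at the parameter `θ`. -/
def tangentLine (θ : ℝ) : AffineSubspace ℝ Plane :=
  planeLine b O (J.cn θ) (J.sn θ) (A * J.dn θ)

/-- The signed distance of a point from a tangent, positive on the side of `O`. -/
def signedDist (θ : ℝ) (z : Plane) : ℝ :=
  A * J.dn θ - (J.cn θ * xcoord b O z + J.sn θ * ycoord b O z)

variable {J b O A}

theorem cn_sq_add_sn_sq (θ : ℝ) : J.cn θ ^ 2 + J.sn θ ^ 2 = 1 := by rw [J.cn_sq]; ring

theorem tangentLine_sSameSide_iff (hA : 0 < A) {θ : ℝ} {z : Plane} :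
    (tangentLine J b O A θ).SSameSide O z ↔ 0 < signedDist J b O A θ z := by
  rw [tangentLine, sSameSide_iff (cn_sq_add_sn_sq θ) (mul_pos hA (J.dn_pos θ)), signedDist, sub_pos]

theorem tangentLine_sOppSide_iff (hA : 0 < A) {θ : ℝ} {z : Plane} :
    (tangentLine J b O A θ).SOppSide O z ↔ signedDist J b O A θ z < 0 := by
  rw [tangentLine, sOppSide_iff (cn_sq_add_sn_sq θ) (mul_pos hA (J.dn_pos θ)), signedDist, sub_neg]

theorem isTangent_tangentLine_iff {θ : ℝ} {S : EuclideanGeometry.Sphere Plane} :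
    S.IsTangent (tangentLine J b O A θ) ↔ S.radius = |signedDist J b O A θ S.center| :=
  isTangent_planeLine_iff (cn_sq_add_sn_sq θ)

theorem abs_signedDist_sub_le (θ : ℝ) (z q : Plane) :
    |signedDist J b O A θ z - signedDist J b O A θ q| ≤ dist z q := by
  refine abs_le_of_sq_le_sq ?_ dist_nonneg
  rw [dist_sq_coords b O, signedDist, signedDist]
  have h := cn_sq_add_sn_sq (J := J) θ
  set x := xcoord b O z - xcoord b O q with hx
  set y := ycoord b O z - ycoord b O q with hy
  have e : A * J.dn θ - (J.cn θ * xcoord b O z + J.sn θ * ycoord b O z) -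
      (A * J.dn θ - (J.cn θ * xcoord b O q + J.sn θ * ycoord b O q)) =
      -(J.cn θ * x + J.sn θ * y) := by rw [hx, hy]; ring
  have e2 : x ^ 2 + y ^ 2 = (J.cn θ * x + J.sn θ * y) ^ 2 + (J.cn θ * y - J.sn θ * x) ^ 2 := by
    linear_combination (-(x ^ 2 + y ^ 2)) * h
  rw [e, e2]
  nlinarith [sq_nonneg (J.cn θ * y - J.sn θ * x)]

/-- Incircles in terms of signed distances. -/
theorem isIncircle_iff (hA : 0 < A) {ι : Type*} {L : ι → AffineSubspace ℝ Plane} {i j k l : ι}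
    {θi θj θk θl : ℝ} (hi : L i = tangentLine J b O A θi) (hj : L j = tangentLine J b O A θj)
    (hk : L k = tangentLine J b O A θk) (hl : L l = tangentLine J b O A θl)
    {S : EuclideanGeometry.Sphere Plane} :
    IsIncircle O L i j k l S ↔ ∃ ρ : ℝ, ρ ≠ 0 ∧ S.radius = |ρ| ∧
      signedDist J b O A θi S.center = ρ ∧ signedDist J b O A θj S.center = -ρ ∧
      signedDist J b O A θk S.center = -ρ ∧ signedDist J b O A θl S.center = ρ := by
  constructor
  · rintro ⟨hr, ti, tj, tk, tl, hsub⟩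
    rw [hi, isTangent_tangentLine_iff] at ti
    rw [hj, isTangent_tangentLine_iff] at tj
    rw [hk, isTangent_tangentLine_iff] at tk
    rw [hl, isTangent_tangentLine_iff] at tl
    -- The sign of the representative of the center becomes the sign of $\rho$: negative
    -- representatives reverse all four sides at once.
    obtain ⟨⟨ε, z⟩, ⟨⟨ci, cj⟩, cl, ck⟩, rfl : z = S.center⟩ := hsub (Metric.mem_ball_self hr)
    simp only [posHalf, negHalf, Set.mem_ofPred_eq, hi, hj, hk, hl, tangentLine_sSameSide_iff hA,
      tangentLine_sOppSide_iff hA] at ci cj ck cl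
    have hne : (1 : ℤˣ) ≠ -1 := by decide
    rcases Int.units_eq_one_or ε with rfl | rfl
    · simp only [hne, true_and, false_and, or_false] at ci cj ck cl
      refine ⟨S.radius, hr.ne', (abs_of_pos hr).symm, ?_, ?_, ?_, ?_⟩
      · rw [ti, abs_of_pos ci]
      · rw [tj, abs_of_neg cj, neg_neg]
      · rw [tk, abs_of_neg ck, neg_neg]
      · rw [tl, abs_of_pos cl]
    · simp only [hne.symm, true_and, false_and, false_or] at ci cj ck cl
      refine ⟨-S.radius, neg_ne_zero.2 hr.ne', by rw [abs_neg, abs_of_pos hr], ?_, ?_, ?_, ?_⟩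
      · rw [ti, abs_of_neg ci, neg_neg]
      · rw [tj, abs_of_pos cj, neg_neg]
      · rw [tk, abs_of_pos ck, neg_neg]
      · rw [tl, abs_of_neg cl, neg_neg]
  · rintro ⟨ρ, h0, hr, di, dj, dk, dl⟩
    refine ⟨by rw [hr]; exact abs_pos.2 h0, ?_, ?_, ?_, ?_, ?_⟩
    · rw [hi, isTangent_tangentLine_iff, di, hr]
    · rw [hj, isTangent_tangentLine_iff, dj, hr, abs_neg]
    · rw [hk, isTangent_tangentLine_iff, dk, hr, abs_neg]
    · rw [hl, isTangent_tangentLine_iff, dl, hr]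
    · intro q hq
      rw [Metric.mem_ball, hr] at hq
      -- Signed distances are 1-Lipschitz, so none of the four changes sign in the open disc of
      -- radius $|\rho|$.
      have key : ∀ θ, |signedDist J b O A θ q - signedDist J b O A θ S.center| < |ρ| :=
        fun θ => (abs_signedDist_sub_le θ q _).trans_lt hq
      have ki := abs_lt.1 (key θi)
      have kj := abs_lt.1 (key θj)
      have kk := abs_lt.1 (key θk)
      have kl := abs_lt.1 (key θl)
      rw [di] at ki
      rw [dj] at kj
      rw [dk] at kk
      rw [dl] at kl
      rcases lt_or_gt_of_ne h0 with hρ | hρ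
      · rw [abs_of_neg hρ] at ki kj kk kl
        refine ⟨(-1, q), ⟨⟨Or.inr ⟨rfl, ?_⟩, Or.inr ⟨rfl, ?_⟩⟩, Or.inr ⟨rfl, ?_⟩, Or.inr ⟨rfl, ?_⟩⟩, rfl⟩
        · rw [hi, tangentLine_sOppSide_iff hA]; linarith
        · rw [hj, tangentLine_sSameSide_iff hA]; linarith
        · rw [hl, tangentLine_sOppSide_iff hA]; linarith
        · rw [hk, tangentLine_sSameSide_iff hA]; linarith
      · rw [abs_of_pos hρ] at ki kj kk kl
        refine ⟨(1, q), ⟨⟨Or.inl ⟨rfl, ?_⟩, Or.inl ⟨rfl, ?_⟩⟩, Or.inl ⟨rfl, ?_⟩, Or.inl ⟨rfl, ?_⟩⟩, rfl⟩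
        · rw [hi, tangentLine_sSameSide_iff hA]; linarith
        · rw [hj, tangentLine_sOppSide_iff hA]; linarith
        · rw [hl, tangentLine_sSameSide_iff hA]; linarith
        · rw [hk, tangentLine_sOppSide_iff hA]; linarith

/-- A line meets the unit circle in at most two points. -/
theorem unit_vectors_pigeonhole {x y c₁ s₁ c₂ s₂ c₃ s₃ r : ℝ} (h1 : c₁ ^ 2 + s₁ ^ 2 = 1)
    (h2 : c₂ ^ 2 + s₂ ^ 2 = 1) (h3 : c₃ ^ 2 + s₃ ^ 2 = 1) (e1 : c₁ * x + s₁ * y = r)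
    (e2 : c₂ * x + s₂ * y = r) (e3 : c₃ * x + s₃ * y = r) (hz : x ^ 2 + y ^ 2 ≠ 0) :
    (c₁ = c₂ ∧ s₁ = s₂) ∨ (c₁ = c₃ ∧ s₁ = s₃) ∨ (c₂ = c₃ ∧ s₂ = s₃) := by
  have eq : ∀ {c s c' s' : ℝ}, c * x + s * y = r → c' * x + s' * y = r →
      s * x - c * y = s' * x - c' * y → c = c' ∧ s = s' := by
    intro c s c' s' h h' h''
    constructor
    · refine mul_right_cancel₀ hz ?_
      linear_combination x * h - x * h' - y * h''
    · refine mul_right_cancel₀ hz ?_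
      linear_combination y * h - y * h' + x * h''
  -- By Lagrange's identity, equal inner products with $(x,y)$ leave only the sign of the cross
  -- product free; among three vectors two signs agree.
  have q12 : (s₁ * x - c₁ * y) ^ 2 = (s₂ * x - c₂ * y) ^ 2 := by
    linear_combination (x ^ 2 + y ^ 2) * (h1 - h2) - (c₁ * x + s₁ * y + r) * e1 +
      (c₂ * x + s₂ * y + r) * e2
  have q13 : (s₁ * x - c₁ * y) ^ 2 = (s₃ * x - c₃ * y) ^ 2 := by
    linear_combination (x ^ 2 + y ^ 2) * (h1 - h3) - (c₁ * x + s₁ * y + r) * e1 +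
      (c₃ * x + s₃ * y + r) * e3
  rcases sq_eq_sq_iff_eq_or_eq_neg.1 q12 with h | h
  · exact Or.inl (eq e1 e2 h)
  · rcases sq_eq_sq_iff_eq_or_eq_neg.1 q13 with h' | h'
    · exact Or.inr (Or.inl (eq e1 e3 h'))
    · exact Or.inr (Or.inr (eq e2 e3 (by linarith)))

/-- The four linear equations of an incircle have at most one solution. -/
theorem center_unique (hκ : κ ^ 2 < 1) {θ₁ θ₂ θ₃ θ₄ : ℝ} (h12 : ¬ J.IsPeriod (2 * (θ₁ - θ₂)))
    (h13 : ¬ J.IsPeriod (2 * (θ₁ - θ₃))) (h42 : ¬ J.IsPeriod (2 * (θ₄ - θ₂)))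
    (hne : ¬ (J.IsPeriod (θ₁ - θ₄) ∧ J.IsPeriod (θ₂ - θ₃)))
    {z z' : Plane} {ρ ρ' : ℝ}
    (e1 : signedDist J b O A θ₁ z = ρ) (e2 : signedDist J b O A θ₂ z = -ρ)
    (e3 : signedDist J b O A θ₃ z = -ρ) (e4 : signedDist J b O A θ₄ z = ρ)
    (e1' : signedDist J b O A θ₁ z' = ρ') (e2' : signedDist J b O A θ₂ z' = -ρ')
    (e3' : signedDist J b O A θ₃ z' = -ρ') (e4' : signedDist J b O A θ₄ z' = ρ') : z = z' := by
  rw [signedDist] at e1 e2 e3 e4 e1' e2' e3' e4'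
  set x := xcoord b O z - xcoord b O z' with hx
  set y := ycoord b O z - ycoord b O z' with hy
  by_contra hzz
  have hxy : x ^ 2 + y ^ 2 ≠ 0 := by
    rw [hx, hy, ← dist_sq_coords]
    exact pow_ne_zero _ (dist_ne_zero.2 hzz)
  -- Subtracting the two systems gives $n_1,n_4,-n_2,-n_3$ the same inner product with $z-z'$. The
  -- hypotheses forbid $n_1$, $n_4$ to be opposite to $n_2$, and $n_1$ to $n_3$, so the pigeonhole
  -- forces $n_1=n_4$ and $n_2=n_3$.
  have f1 : J.cn θ₁ * x + J.sn θ₁ * y = ρ' - ρ := by rw [hx, hy]; linear_combination e1' - e1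
  have f4 : J.cn θ₄ * x + J.sn θ₄ * y = ρ' - ρ := by rw [hx, hy]; linear_combination e4' - e4
  have f2 : -J.cn θ₂ * x + -J.sn θ₂ * y = ρ' - ρ := by rw [hx, hy]; linear_combination e2 - e2'
  have f3 : -J.cn θ₃ * x + -J.sn θ₃ * y = ρ' - ρ := by rw [hx, hy]; linear_combination e3 - e3'
  have n : ∀ θ, (-J.cn θ) ^ 2 + (-J.sn θ) ^ 2 = 1 := fun θ => by
    rw [neg_sq, neg_sq]; exact cn_sq_add_sn_sq θ
  refine hne ⟨?_, ?_⟩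
  · rcases unit_vectors_pigeonhole (cn_sq_add_sn_sq θ₁) (cn_sq_add_sn_sq θ₄) (n θ₂) f1 f4 f2 hxy
      with h | h | h
    · exact (isPeriod_sub_iff hκ).2 h.symm
    · exact (h12 (isPeriod_two_mul_sub hκ h.2 h.1)).elim
    · exact (h42 (isPeriod_two_mul_sub hκ h.2 h.1)).elim
  · rcases unit_vectors_pigeonhole (cn_sq_add_sn_sq θ₁) (n θ₂) (n θ₃) f1 f2 f3 hxy
      with h | h | h
    · exact (h12 (isPeriod_two_mul_sub hκ h.2 h.1)).elim
    · exact (h13 (isPeriod_two_mul_sub hκ h.2 h.1)).elim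
    · exact (isPeriod_sub_iff hκ).2 ⟨neg_inj.1 h.2, neg_inj.1 h.1⟩

variable (J b O A) in
/-- The point `A (cn w dn α dn β, (1 - κ²) sn w) / (dn w cn α cn β)`. -/
def gridPoint (w α β : ℝ) : Plane :=
  ofCoords b O (A * (J.cn w * (J.dn α * J.dn β)) / (J.dn w * (J.cn α * J.cn β)))
    (A * ((1 - κ ^ 2) * J.sn w) / (J.dn w * (J.cn α * J.cn β)))

variable (J A) in
/-- The signed radius of the incircle around a grid point. -/
def gridRadius (w α β : ℝ) : ℝ :=
  A * ((1 - κ ^ 2) * (J.sn α * J.sn β)) / (J.dn w * (J.cn α * J.cn β))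

/-- This is `incircle_identity` after division by `J.dn w * J.cn α * J.cn β`. Changing the signs of
`α` and `β` then yields all four tangents $w\pm\alpha\pm\beta$ at once. -/
theorem signedDist_gridPoint (hκ : κ ^ 2 < 1) {α β : ℝ} (hα : J.cn α ≠ 0) (hβ : J.cn β ≠ 0)
    (w : ℝ) : signedDist J b O A (w + (α + β)) (gridPoint J b O A w α β) =
      gridRadius J A w α β := by
  have h := J.incircle_identity hκ w α β
  have hd := (J.dn_pos w).ne'
  rw [signedDist, gridPoint, gridRadius, xcoord_ofCoords, ycoord_ofCoords]
  field_simp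
  linear_combination -A * h

theorem gridPoint_neg_left (hκ : κ ^ 2 < 1) (w α β : ℝ) :
    gridPoint J b O A w (-α) β = gridPoint J b O A w α β := by
  rw [gridPoint, gridPoint, J.cn_neg hκ, J.dn_neg hκ]

theorem gridPoint_neg_right (hκ : κ ^ 2 < 1) (w α β : ℝ) :
    gridPoint J b O A w α (-β) = gridPoint J b O A w α β := by
  rw [gridPoint, gridPoint, J.cn_neg hκ, J.dn_neg hκ]

theorem gridPoint_comm (w α β : ℝ) : gridPoint J b O A w α β = gridPoint J b O A w β α := by
  rw [gridPoint, gridPoint, mul_comm (J.dn α), mul_comm (J.cn α)]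

theorem gridRadius_neg_left (hκ : κ ^ 2 < 1) (w α β : ℝ) :
    gridRadius J A w (-α) β = -gridRadius J A w α β := by
  rw [gridRadius, gridRadius, J.cn_neg hκ, J.sn_neg hκ]; ring

theorem gridRadius_neg_right (hκ : κ ^ 2 < 1) (w α β : ℝ) :
    gridRadius J A w α (-β) = -gridRadius J A w α β := by
  rw [gridRadius, gridRadius, J.cn_neg hκ, J.sn_neg hκ]; ring

end PonceletIncircle

end

/-! ### Bisectors, and why distinct data give distinct points and lines. -/

noncomputable section

namespace PonceletIncircle

open JacobiFunctions

variable {κ : ℝ} {J : JacobiFunctions κ} {b : OrthonormalBasis (Fin 2) ℝ Plane} {O : Plane} {A : ℝ}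

variable (J b O A) in
/-- The bisector of the tangents at the parameters `w - α` and `w + α`. -/
def bisector (w α : ℝ) : AffineSubspace ℝ Plane :=
  planeLine b O (J.cn w * J.cn α) (J.sn w * J.cn α * J.dn α) (A * (J.dn w * J.dn α))

theorem bisector_normal_ne_zero {α : ℝ} (hα : J.cn α ≠ 0) (w : ℝ) :
    J.cn w * J.cn α ≠ 0 ∨ J.sn w * J.cn α * J.dn α ≠ 0 := by
  by_cases h : J.cn w = 0
  · right
    refine mul_ne_zero (mul_ne_zero (fun h' => ?_) hα) (J.dn_pos α).ne'
    have := J.cn_sq w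
    rw [h, h'] at this
    norm_num at this
  · exact Or.inl (mul_ne_zero h hα)

/-- The addition formulas for $w+\alpha$ and $w-\alpha$ share a denominator, and their sums collapse
to the products $2\,\mathrm{cn}\,w\,\mathrm{cn}\,\alpha$,
$2\,\mathrm{sn}\,w\,\mathrm{cn}\,\alpha\,\mathrm{dn}\,\alpha$ and
$2\,\mathrm{dn}\,w\,\mathrm{dn}\,\alpha$. -/
theorem mem_bisector (hκ : κ ^ 2 < 1) {w α : ℝ} {z : Plane}
    (h : signedDist J b O A (w + -α) z + signedDist J b O A (w + α) z = 0) :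
    z ∈ bisector J b O A w α := by
  have c1 := J.cn_add hκ w α
  have c2 := J.cn_add hκ w (-α)
  have s1 := J.sn_add hκ w α
  have s2 := J.sn_add hκ w (-α)
  have d1 := J.dn_add hκ w α
  have d2 := J.dn_add hκ w (-α)
  rw [J.sn_neg hκ, J.cn_neg hκ, J.dn_neg hκ, neg_sq] at c2 s2 d2
  rw [signedDist, signedDist] at h
  rw [bisector, mem_planeLine]
  linear_combination (-(1 - κ ^ 2 * J.sn w ^ 2 * J.sn α ^ 2) / 2) * h +
    A / 2 * (d1 + d2) - xcoord b O z / 2 * (c1 + c2) - ycoord b O z / 2 * (s1 + s2)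

/-- The equation of a line is determined up to a factor. -/
theorem planeLine_inj {g₁ g₂ h g₁' g₂' h' : ℝ} (hg : g₁ ≠ 0 ∨ g₂ ≠ 0)
    (he : planeLine b O g₁ g₂ h = planeLine b O g₁' g₂' h') :
    h' * g₁ = h * g₁' ∧ h' * g₂ = h * g₂' := by
  have hpos : 0 < g₁ ^ 2 + g₂ ^ 2 := by rcases hg with hg | hg <;> positivity
  have m1 : ofCoords b O (h / (g₁ ^ 2 + g₂ ^ 2) * g₁) (h / (g₁ ^ 2 + g₂ ^ 2) * g₂) ∈
      planeLine b O g₁ g₂ h := by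
    rw [mem_planeLine, xcoord_ofCoords, ycoord_ofCoords]; field_simp
  have m2 : ofCoords b O (h / (g₁ ^ 2 + g₂ ^ 2) * g₁ - g₂) (h / (g₁ ^ 2 + g₂ ^ 2) * g₂ + g₁) ∈
      planeLine b O g₁ g₂ h := by
    rw [mem_planeLine, xcoord_ofCoords, ycoord_ofCoords]; field_simp; ring
  rw [he, mem_planeLine, xcoord_ofCoords, ycoord_ofCoords] at m1 m2
  have hr : h / (g₁ ^ 2 + g₂ ^ 2) * (g₁ ^ 2 + g₂ ^ 2) = h := div_mul_cancel₀ _ hpos.ne'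
  generalize h / (g₁ ^ 2 + g₂ ^ 2) = r at *
  subst hr
  have h3 : g₁ * g₂' = g₂ * g₁' := by linear_combination m2 - m1
  constructor
  · linear_combination -g₁ * m1 + r * g₂ * h3
  · linear_combination -g₂ * m1 - r * g₁ * h3

/-- Points on nested confocal ellipses do not coincide. -/
theorem nested_le {k a a' C C' : ℝ} (hk0 : 0 ≤ k) (hk : k < 1) (ha : 0 ≤ a) (ha' : 0 ≤ a')
    (hC : 0 < C) (hC' : 0 < C') (hC1 : C' ≤ 1)
    (e1 : a * (1 - k + k * C) * ((1 - k + k * a') * C') =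
      a' * (1 - k + k * C') * ((1 - k + k * a) * C))
    (e2 : (1 - a) * ((1 - k + k * a') * C') = (1 - a') * ((1 - k + k * a) * C)) : C' ≤ C := by
  by_contra! hlt
  have h1k : 0 < 1 - k := by linarith
  have e3 : a * (1 - k + k * a') * C' + k * C * C' * a =
      a' * (1 - k + k * a) * C + k * C * C' * a' := by
    refine mul_left_cancel₀ h1k.ne' ?_
    linear_combination e1
  -- If $C<C'$, this excludes $a\le a'$. But then $a'<a$ makes every term of the difference of the
  -- two sides of `e3` nonnegative and one of them positive.
  have e4 : (1 - k) * (C' - C) + k * (a' * C' * (1 - C) - a * C * (1 - C')) = 0 := by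
    linear_combination e2 + e3
  have h5 : a' < a := by
    by_contra! hle
    have : a * C * (1 - C') ≤ a' * C' * (1 - C) :=
      mul_le_mul (mul_le_mul hle hlt.le hC.le ha') (by linarith) (by linarith)
        (mul_nonneg ha' hC'.le)
    have h6 := mul_nonneg hk0 (sub_nonneg.2 this)
    have h7 := mul_pos h1k (sub_pos.2 hlt)
    linarith
  have h8 : a' * C < a * C' := mul_lt_mul'' h5 hlt ha' hC.le
  have h9 : 0 ≤ k * (a * a') * (C' - C) :=
    mul_nonneg (mul_nonneg hk0 (mul_nonneg ha ha')) (sub_nonneg.2 hlt.le)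
  have h10 : 0 ≤ k * (C * C') * (a - a') :=
    mul_nonneg (mul_nonneg hk0 (mul_pos hC hC').le) (sub_nonneg.2 h5.le)
  have h11 := mul_pos h1k (sub_pos.2 h8)
  nlinarith

/-- The equations say that the tangents at $w\pm\alpha$ and those at $w'\pm\alpha'$ meet in the same
point. After squaring, `nested_le` applies in both directions with $k=\kappa^2$, $a=\mathrm{cn}^2w$
and $C=\mathrm{cn}^2\alpha$. -/
theorem cn_sq_eq_of_nested (hκ : κ ^ 2 < 1) {w w' α α' : ℝ} (hα : J.cn α ≠ 0) (hα' : J.cn α' ≠ 0)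
    (e1 : J.cn w * J.dn α * (J.dn w' * J.cn α') = J.cn w' * J.dn α' * (J.dn w * J.cn α))
    (e2 : J.sn w * (J.dn w' * J.cn α') = J.sn w' * (J.dn w * J.cn α)) :
    J.cn α ^ 2 = J.cn α' ^ 2 := by
  have dn : ∀ x, J.dn x ^ 2 = 1 - κ ^ 2 + κ ^ 2 * J.cn x ^ 2 := fun x => by
    rw [J.dn_sq, J.cn_sq]; ring
  have sn : ∀ x, J.sn x ^ 2 = 1 - J.cn x ^ 2 := fun x => by rw [J.cn_sq]; ring
  have le1 : ∀ x, J.cn x ^ 2 ≤ 1 := fun x => by rw [J.cn_sq]; nlinarith [sq_nonneg (J.sn x)]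
  have p := sq_pos_of_ne_zero hα
  have p' := sq_pos_of_ne_zero hα'
  have f1 := congrArg (· ^ 2) e1
  have f2 := congrArg (· ^ 2) e2
  simp only [mul_pow, dn, sn] at f1 f2
  refine le_antisymm ?_ ?_
  · exact nested_le (sq_nonneg κ) hκ (sq_nonneg _) (sq_nonneg _) p' p (le1 _)
      f1.symm f2.symm
  · exact nested_le (sq_nonneg κ) hκ (sq_nonneg _) (sq_nonneg _) p p' (le1 _)
      f1 f2

/-- The two unit normals are positive multiples of each other, hence equal. -/
theorem isPeriod_sub_of_ratio_eq (hκ : κ ^ 2 < 1) {w w' : ℝ}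
    (e1 : J.cn w * J.dn w' = J.cn w' * J.dn w) (e2 : J.sn w * J.dn w' = J.sn w' * J.dn w) :
    J.IsPeriod (w - w') := by
  have hd : J.dn w' = J.dn w := by
    refine (pow_left_inj₀ (J.dn_pos _).le (J.dn_pos _).le two_ne_zero).1 ?_
    linear_combination (J.cn w * J.dn w' + J.cn w' * J.dn w) * e1 +
      (J.sn w * J.dn w' + J.sn w' * J.dn w) * e2 + J.dn w ^ 2 * cn_sq_add_sn_sq (J := J) w' -
      J.dn w' ^ 2 * cn_sq_add_sn_sq (J := J) w
  rw [hd] at e1 e2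
  exact (isPeriod_sub_iff hκ).2 ⟨mul_right_cancel₀ (J.dn_pos w).ne' e2,
    mul_right_cancel₀ (J.dn_pos w).ne' e1⟩

/-- The shared `α` enters only through a scaling of each axis and cancels. What remains compares the
intersections of the tangents at $w\pm\beta$ and at $w'\pm\gamma$. -/
theorem gridPoint_eq (hκ : κ ^ 2 < 1) (hA : 0 < A) {w w' α β γ : ℝ} (hα : J.cn α ≠ 0)
    (hβ : J.cn β ≠ 0) (hγ : J.cn γ ≠ 0)
    (h : gridPoint J b O A w α β = gridPoint J b O A w' α γ) :
    J.cn w * J.dn β * (J.dn w' * J.cn γ) = J.cn w' * J.dn γ * (J.dn w * J.cn β) ∧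
      J.sn w * (J.dn w' * J.cn γ) = J.sn w' * (J.dn w * J.cn β) := by
  have h1 := congrArg (xcoord b O) h
  have h2 := congrArg (ycoord b O) h
  have hw := (J.dn_pos w).ne'
  have hw' := (J.dn_pos w').ne'
  have hd := (J.dn_pos α).ne'
  have hk : 1 - κ ^ 2 ≠ 0 := by linarith
  rw [gridPoint, gridPoint, xcoord_ofCoords, xcoord_ofCoords,
    div_eq_div_iff (by positivity) (by positivity)] at h1
  rw [gridPoint, gridPoint, ycoord_ofCoords, ycoord_ofCoords,
    div_eq_div_iff (by positivity) (by positivity)] at h2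
  constructor
  · refine mul_left_cancel₀ (mul_ne_zero hA.ne' (mul_ne_zero hd hα)) ?_
    linear_combination h1
  · refine mul_left_cancel₀ (mul_ne_zero hA.ne' (mul_ne_zero hk hα)) ?_
    linear_combination h2

/-- Proportionality of the two equations gives the system of `gridPoint_eq` with `α` and `β`
interchanged, so points and lines are separated by the same argument. -/
theorem bisector_eq (hA : 0 < A) {w w' α β : ℝ} (hα : J.cn α ≠ 0)
    (h : bisector J b O A w α = bisector J b O A w' β) :
    J.cn w * J.dn β * (J.dn w' * J.cn α) = J.cn w' * J.dn α * (J.dn w * J.cn β) ∧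
      J.sn w * (J.dn w' * J.cn α) = J.sn w' * (J.dn w * J.cn β) := by
  obtain ⟨h1, h2⟩ := planeLine_inj (bisector_normal_ne_zero hα w) h
  have hd := (J.dn_pos α).ne'
  have hd' := (J.dn_pos β).ne'
  constructor
  · refine mul_left_cancel₀ hA.ne' ?_
    linear_combination h1
  · refine mul_left_cancel₀ (mul_ne_zero hA.ne' (mul_ne_zero hd hd')) ?_
    linear_combination h2

end PonceletIncircle

end

/-! ### Incircles and bisectors of the Poncelet grid. -/

noncomputable section

namespace PonceletIncircle

open JacobiFunctions

variable {κ : ℝ} {J : JacobiFunctions κ} {b : OrthonormalBasis (Fin 2) ℝ Plane} {O : Plane}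
  {A u τ : ℝ} {m : ℕ} {L : ZMod m → AffineSubspace ℝ Plane}

variable (J b O A u τ) in
/-- The center of the incircle of the square cell of type `(k, l)` at position `i`. -/
def gridCenter (i k l : ℤ) : Plane :=
  gridPoint J b O A (u + (i + (k + l) / 2) * τ) (k * τ / 2) (l * τ / 2)

variable (J A u τ) in
/-- The signed radius of the incircle of the square cell of type `(k, l)` at position `i`. -/
def centerRadius (i k l : ℤ) : ℝ :=
  gridRadius J A (u + (i + (k + l) / 2) * τ) (k * τ / 2) (l * τ / 2)

variable (J b O A u τ) in
/-- The bisector of the double wedge of the lines `i` and `i + k`. -/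
def wedgeLine (i k : ℤ) : AffineSubspace ℝ Plane :=
  bisector J b O A (u + (i + k / 2) * τ) (k * τ / 2)

theorem gridCenter_comm (i k l : ℤ) :
    gridCenter J b O A u τ i k l = gridCenter J b O A u τ i l k := by
  rw [gridCenter, gridCenter, gridPoint_comm, add_comm (k : ℝ)]

namespace IsJacobiProgression

theorem line_eq' (H : IsJacobiProgression J b O A u τ L) {j : ℤ} {θ : ℝ} (h : u + j * τ = θ) :
    L j = tangentLine J b O A θ := by
  rw [H.line_eq, h, tangentLine]

/-- A zero of `cn` at $k\tau/2$ would make $2k\tau$ a period; this is where $k\neq m/2$ matters. -/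
theorem cn_half_ne_zero (hκ : κ ^ 2 < 1) (H : IsJacobiProgression J b O A u τ L) {k : ℤ}
    (hk : 2 * (k : ZMod m) ≠ 0) : J.cn (k * τ / 2) ≠ 0 := by
  intro h
  have := isPeriod_four_mul_of_cn_eq_zero hκ h
  rw [show 2 * (2 * (k * τ / 2)) = ((2 * k : ℤ) : ℝ) * τ by push_cast; ring, H.isPeriod_iff] at this
  exact hk (by exact_mod_cast this)

theorem sn_half_ne_zero (hκ : κ ^ 2 < 1) (H : IsJacobiProgression J b O A u τ L) {k : ℤ}
    (hk : 2 * (k : ZMod m) ≠ 0) : J.sn (k * τ / 2) ≠ 0 := by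
  intro h
  have := isPeriod_two_mul_of_sn_eq_zero hκ h
  rw [show 2 * (k * τ / 2) = (k : ℝ) * τ by ring, H.isPeriod_iff] at this
  exact hk (by rw [this, mul_zero])

theorem isPeriod_iff_of_eq (H : IsJacobiProgression J b O A u τ L) {j : ℤ} {θ : ℝ}
    (h : j * τ = θ) : J.IsPeriod θ ↔ (j : ZMod m) = 0 := by
  rw [← h, H.isPeriod_iff]

theorem isSquareIncircle_iff_exists (H : IsJacobiProgression J b O A u τ L) (hA : 0 < A)
    (i k l : ℤ) {S : EuclideanGeometry.Sphere Plane} :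
    IsSquareIncircle O L i k l S ↔ ∃ ρ : ℝ, ρ ≠ 0 ∧ S.radius = |ρ| ∧
      signedDist J b O A (u + i * τ) S.center = ρ ∧
      signedDist J b O A (u + (i + l) * τ) S.center = -ρ ∧
      signedDist J b O A (u + (i + k) * τ) S.center = -ρ ∧
      signedDist J b O A (u + (i + k + l) * τ) S.center = ρ := by
  refine isIncircle_iff hA (H.line_eq' rfl) ?_ ?_ ?_
  · rw [← Int.cast_add]; exact H.line_eq' (by push_cast; ring)
  · rw [← Int.cast_add]; exact H.line_eq' (by push_cast; ring)
  · rw [← Int.cast_add, ← Int.cast_add]; exact H.line_eq' (by push_cast; ring)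

theorem signedDist_gridCenter (hκ : κ ^ 2 < 1) (H : IsJacobiProgression J b O A u τ L)
    {i k l : ℤ} (hk : 2 * (k : ZMod m) ≠ 0) (hl : 2 * (l : ZMod m) ≠ 0) :
    signedDist J b O A (u + i * τ) (gridCenter J b O A u τ i k l) = centerRadius J A u τ i k l ∧
    signedDist J b O A (u + (i + l) * τ) (gridCenter J b O A u τ i k l) =
      -centerRadius J A u τ i k l ∧
    signedDist J b O A (u + (i + k) * τ) (gridCenter J b O A u τ i k l) =
      -centerRadius J A u τ i k l ∧
    signedDist J b O A (u + (i + k + l) * τ) (gridCenter J b O A u τ i k l) =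
      centerRadius J A u τ i k l := by
  have ck := H.cn_half_ne_zero hκ hk
  have cl := H.cn_half_ne_zero hκ hl
  have ck' : J.cn (-(k * τ / 2)) ≠ 0 := by rwa [J.cn_neg hκ]
  have cl' : J.cn (-(l * τ / 2)) ≠ 0 := by rwa [J.cn_neg hκ]
  have e1 := signedDist_gridPoint (b := b) (O := O) (A := A) hκ ck' cl'
    (u + (i + (k + l) / 2) * τ)
  have e2 := signedDist_gridPoint (b := b) (O := O) (A := A) hκ ck' cl
    (u + (i + (k + l) / 2) * τ)
  have e3 := signedDist_gridPoint (b := b) (O := O) (A := A) hκ ck cl'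
    (u + (i + (k + l) / 2) * τ)
  have e4 := signedDist_gridPoint (b := b) (O := O) (A := A) hκ ck cl
    (u + (i + (k + l) / 2) * τ)
  rw [gridPoint_neg_left hκ, gridPoint_neg_right hκ, gridRadius_neg_left hκ,
    gridRadius_neg_right hκ, neg_neg] at e1
  rw [gridPoint_neg_left hκ, gridRadius_neg_left hκ] at e2
  rw [gridPoint_neg_right hκ, gridRadius_neg_right hκ] at e3
  refine ⟨?_, ?_, ?_, ?_⟩
  · rw [gridCenter, centerRadius, ← e1]; congr 1; ring
  · rw [gridCenter, centerRadius, ← e2]; congr 1; ring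
  · rw [gridCenter, centerRadius, ← e3]; congr 1; ring
  · rw [gridCenter, centerRadius, ← e4]; congr 1; ring

/-- The incircle of a square cell exists and is unique. -/
theorem isSquareIncircle_iff (hκ : κ ^ 2 < 1) (hA : 0 < A)
    (H : IsJacobiProgression J b O A u τ L) {i k l : ℤ} (hk : 2 * (k : ZMod m) ≠ 0)
    (hl : 2 * (l : ZMod m) ≠ 0) {S : EuclideanGeometry.Sphere Plane} :
    IsSquareIncircle O L i k l S ↔
      S = ⟨gridCenter J b O A u τ i k l, |centerRadius J A u τ i k l|⟩ := by
  obtain ⟨g1, g2, g3, g4⟩ := H.signedDist_gridCenter hκ (i := i) hk hl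
  rw [H.isSquareIncircle_iff_exists hA]
  constructor
  · rintro ⟨ρ, h0, hr, e1, e2, e3, e4⟩
    have hc : S.center = gridCenter J b O A u τ i k l := by
      refine center_unique hκ ?_ ?_ ?_ ?_ e1 e2 e3 e4 g1 g2 g3 g4
      · rw [H.isPeriod_iff_of_eq (j := -(2 * l)) (by push_cast; ring)]
        push_cast; rwa [neg_eq_zero]
      · rw [H.isPeriod_iff_of_eq (j := -(2 * k)) (by push_cast; ring)]
        push_cast; rwa [neg_eq_zero]
      · rw [H.isPeriod_iff_of_eq (j := 2 * k) (by push_cast; ring)]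
        push_cast; exact hk
      -- For $l=\pm k$ two of the four lines coincide, which uniqueness tolerates. Both pairs could
      -- coincide only if $k+l=0=l-k$, that is, $2k=0$.
      · rw [H.isPeriod_iff_of_eq (j := -(k + l)) (by push_cast; ring),
          H.isPeriod_iff_of_eq (j := l - k) (by push_cast; ring)]
        push_cast
        rintro ⟨h1, h2⟩
        exact hk (by linear_combination -h1 - h2)
    refine EuclideanGeometry.Sphere.ext hc ?_
    rw [hr, ← e1, hc, g1]
  · rintro rfl
    refine ⟨centerRadius J A u τ i k l, ?_, rfl, g1, g2, g3, g4⟩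
    have hκ' : 1 - κ ^ 2 ≠ 0 := by linarith
    exact div_ne_zero (mul_ne_zero hA.ne' (mul_ne_zero hκ' (mul_ne_zero
      (H.sn_half_ne_zero hκ hk) (H.sn_half_ne_zero hκ hl))))
      (mul_ne_zero (J.dn_pos _).ne' (mul_ne_zero (H.cn_half_ne_zero hκ hk)
        (H.cn_half_ne_zero hκ hl)))

theorem gridCenter_mem_squareCenters (hκ : κ ^ 2 < 1) (hA : 0 < A)
    (H : IsJacobiProgression J b O A u τ L) (i : ℤ) {k l : ℤ} (hk : 2 * (k : ZMod m) ≠ 0)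
    (hl : 2 * (l : ZMod m) ≠ 0) : gridCenter J b O A u τ i k l ∈ squareCenters O L k l :=
  ⟨i, _, (H.isSquareIncircle_iff hκ hA hk hl).2 rfl, rfl⟩

theorem gridCenter_mem_wedgeCenters (hκ : κ ^ 2 < 1) (hA : 0 < A)
    (H : IsJacobiProgression J b O A u τ L) (i : ℤ) {k l : ℤ} (hk : 2 * (k : ZMod m) ≠ 0)
    (hl : 2 * (l : ZMod m) ≠ 0) : gridCenter J b O A u τ i k l ∈ wedgeCenters O L i k :=
  ⟨l, _, hl, (H.isSquareIncircle_iff hκ hA hk hl).2 rfl, rfl⟩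

theorem squareCenters_eq_range (hκ : κ ^ 2 < 1) (hA : 0 < A)
    (H : IsJacobiProgression J b O A u τ L) [NeZero m] {k l : ℤ} (hk : 2 * (k : ZMod m) ≠ 0)
    (hl : 2 * (l : ZMod m) ≠ 0) :
    squareCenters O L k l = Set.range fun i : ZMod m => gridCenter J b O A u τ i.val k l := by
  ext z
  constructor
  · rintro ⟨i, S, hS, rfl⟩
    have hi : ((i.val : ℤ) : ZMod m) = i := by simp
    rw [← hi, H.isSquareIncircle_iff hκ hA hk hl] at hS
    exact ⟨i, by rw [hS]⟩
  · rintro ⟨i, rfl⟩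
    exact H.gridCenter_mem_squareCenters hκ hA _ hk hl

theorem squareCenters_comm (hκ : κ ^ 2 < 1) (hA : 0 < A)
    (H : IsJacobiProgression J b O A u τ L) [NeZero m] {k l : ℤ} (hk : 2 * (k : ZMod m) ≠ 0)
    (hl : 2 * (l : ZMod m) ≠ 0) : squareCenters O L k l = squareCenters O L l k := by
  rw [H.squareCenters_eq_range hκ hA hk hl, H.squareCenters_eq_range hκ hA hl hk]
  simp only [gridCenter_comm _ k l]

theorem mem_wedgeLine (hκ : κ ^ 2 < 1) {i k : ℤ} {z : Plane}
    (h : signedDist J b O A (u + i * τ) z + signedDist J b O A (u + (i + k) * τ) z = 0) :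
    z ∈ wedgeLine J b O A u τ i k := by
  refine mem_bisector hκ ?_
  rw [← h]
  congr 2 <;> ring

theorem wedgeCenters_subset (hκ : κ ^ 2 < 1) (hA : 0 < A)
    (H : IsJacobiProgression J b O A u τ L) [NeZero m] {i k : ℤ} {z : Plane}
    (hz : z ∈ wedgeCenters O L i k) : z ∈ wedgeLine J b O A u τ i k := by
  obtain ⟨l, S, -, hS, rfl⟩ := hz
  have hl : ((l.val : ℤ) : ZMod m) = l := by simp
  rw [← hl, H.isSquareIncircle_iff_exists hA] at hS
  obtain ⟨ρ, -, -, e1, -, e3, -⟩ := hS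
  exact mem_wedgeLine hκ (by rw [e1, e3, add_neg_cancel])

theorem gridCenter_mem_wedgeLines (hκ : κ ^ 2 < 1) (H : IsJacobiProgression J b O A u τ L)
    (i : ℤ) {k l : ℤ} (hk : 2 * (k : ZMod m) ≠ 0) (hl : 2 * (l : ZMod m) ≠ 0) :
    gridCenter J b O A u τ i k l ∈ wedgeLine J b O A u τ i k ∧
      gridCenter J b O A u τ i k l ∈ wedgeLine J b O A u τ (i + l) k := by
  obtain ⟨g1, g2, g3, g4⟩ := H.signedDist_gridCenter hκ (i := i) hk hl
  refine ⟨mem_wedgeLine hκ (by rw [g1, g3, add_neg_cancel]), mem_wedgeLine hκ ?_⟩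
  push_cast
  rw [g2, show (i + l + k : ℝ) = i + k + l by ring, g4, neg_add_cancel]

theorem collinear_wedgeCenters (hκ : κ ^ 2 < 1) (hA : 0 < A)
    (H : IsJacobiProgression J b O A u τ L) [NeZero m] (i : ℤ) {k : ℤ}
    (hk : 2 * (k : ZMod m) ≠ 0) : Collinear ℝ (wedgeCenters O L i k) :=
  (collinear_planeLine (bisector_normal_ne_zero (H.cn_half_ne_zero hκ hk) _)).subset
    fun _ hz => H.wedgeCenters_subset hκ hA hz

/-- Up to sign, $k\tau$ and $l\tau$ agree modulo periods, so $m$ divides $k-l$ or $k+l$. The bounds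
by $m/2$ leave only $k=l$. -/
theorem eq_of_cn_sq_eq (hκ : κ ^ 2 < 1) (H : IsJacobiProgression J b O A u τ L) {k l : ℕ}
    (hk0 : 0 < k) (hk : 2 * k < m) (hl : 2 * l < m)
    (h : J.cn (k * τ / 2) ^ 2 = J.cn (l * τ / 2) ^ 2) : k = l := by
  have hs : J.sn (k * τ / 2) ^ 2 = J.sn (l * τ / 2) ^ 2 := by
    rw [J.cn_sq, J.cn_sq] at h; linarith
  rcases isPeriod_of_sn_sq_eq hκ hs with h | h
  · rw [H.isPeriod_iff_of_eq (j := (k : ℤ) - l) (by push_cast; ring),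
      ZMod.intCast_zmod_eq_zero_iff_dvd] at h
    have := Int.eq_zero_of_abs_lt_dvd h (by rw [abs_lt]; omega)
    omega
  · rw [H.isPeriod_iff_of_eq (j := (k : ℤ) + l) (by push_cast; ring),
      ZMod.intCast_zmod_eq_zero_iff_dvd] at h
    have := Int.eq_zero_of_abs_lt_dvd h (by rw [abs_lt]; omega)
    omega

theorem type_eq_of_gridCenter_eq (hκ : κ ^ 2 < 1) (hA : 0 < A)
    (H : IsJacobiProgression J b O A u τ L) {i j k : ℤ} {l l' : ℕ} (hl0 : 0 < l)
    (hl : 2 * l < m) (hl' : 2 * l' < m) (ck : J.cn (k * τ / 2) ≠ 0) (cl : J.cn (l * τ / 2) ≠ 0)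
    (cl' : J.cn (l' * τ / 2) ≠ 0)
    (h : gridCenter J b O A u τ i k l = gridCenter J b O A u τ j k l') : l = l' := by
  obtain ⟨e1, e2⟩ := gridPoint_eq hκ hA ck cl cl' h
  simp only [Int.cast_natCast] at e1 e2
  exact H.eq_of_cn_sq_eq hκ hl0 hl hl' (cn_sq_eq_of_nested hκ cl cl' e1 e2)

theorem index_eq_of_isPeriod (H : IsJacobiProgression J b O A u τ L) {i j : ℤ} (x : ℝ)
    (h : J.IsPeriod (u + (i + x) * τ - (u + (j + x) * τ))) : (i : ZMod m) = j := by
  rw [H.isPeriod_iff_of_eq (j := i - j) (by push_cast; ring)] at h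
  push_cast at h
  exact sub_eq_zero.1 h

theorem index_eq_of_gridCenter_eq (hκ : κ ^ 2 < 1) (hA : 0 < A)
    (H : IsJacobiProgression J b O A u τ L) {i j k l : ℤ} (ck : J.cn (k * τ / 2) ≠ 0)
    (cl : J.cn (l * τ / 2) ≠ 0)
    (h : gridCenter J b O A u τ i k l = gridCenter J b O A u τ j k l) : (i : ZMod m) = j := by
  obtain ⟨e1, e2⟩ := gridPoint_eq hκ hA ck cl cl h
  refine H.index_eq_of_isPeriod ((k + l) / 2) (isPeriod_sub_of_ratio_eq hκ ?_ ?_)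
  · refine mul_left_cancel₀ (mul_ne_zero (J.dn_pos (l * τ / 2)).ne' cl) ?_
    linear_combination e1
  · refine mul_left_cancel₀ cl ?_
    linear_combination e2

theorem type_eq_of_wedgeLine_eq (hκ : κ ^ 2 < 1) (hA : 0 < A)
    (H : IsJacobiProgression J b O A u τ L) {i j : ℤ} {k k' : ℕ} (hk0 : 0 < k)
    (hk : 2 * k < m) (hk' : 2 * k' < m) (ck : J.cn (k * τ / 2) ≠ 0)
    (ck' : J.cn (k' * τ / 2) ≠ 0)
    (h : wedgeLine J b O A u τ i k = wedgeLine J b O A u τ j k') : k = k' := by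
  simp only [wedgeLine, Int.cast_natCast] at h
  obtain ⟨e1, e2⟩ := bisector_eq hA ck h
  exact H.eq_of_cn_sq_eq hκ hk0 hk hk' (cn_sq_eq_of_nested hκ ck' ck e1 e2).symm

theorem index_eq_of_wedgeLine_eq (hκ : κ ^ 2 < 1) (hA : 0 < A)
    (H : IsJacobiProgression J b O A u τ L) {i j k : ℤ} (ck : J.cn (k * τ / 2) ≠ 0)
    (h : wedgeLine J b O A u τ i k = wedgeLine J b O A u τ j k) : (i : ZMod m) = j := by
  obtain ⟨e1, e2⟩ := bisector_eq hA ck h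
  refine H.index_eq_of_isPeriod (k / 2) (isPeriod_sub_of_ratio_eq hκ ?_ ?_)
  · refine mul_left_cancel₀ (mul_ne_zero (J.dn_pos (k * τ / 2)).ne' ck) ?_
    linear_combination e1
  · refine mul_left_cancel₀ ck ?_
    linear_combination e2

end IsJacobiProgression

end PonceletIncircle

end

/-! ### Counting: the pre-$(n_4)$ configuration. -/

noncomputable section

namespace PonceletIncircle

open JacobiFunctions

theorem encard_range_union_range_union_range {α : Type*} {m : ℕ} [NeZero m] {f g h : ZMod m → α}
    (hf : Function.Injective f) (hg : Function.Injective g) (hh : Function.Injective h)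
    (hfg : ∀ i j, f i ≠ g j) (hgh : ∀ i j, g i ≠ h j) (hfh : ∀ i j, f i ≠ h j) :
    (Set.range f ∪ Set.range g ∪ Set.range h).encard = (3 * m : ℕ) := by
  have card : ∀ {k : ZMod m → α}, Function.Injective k → (Set.range k).encard = m := by
    intro k hk
    rw [← Set.image_univ, hk.encard_image, Set.encard_univ, ENat.card_eq_coe_natCard,
      Nat.card_zmod]
  rw [Set.encard_union_eq, Set.encard_union_eq, card hf, card hg, card hh]
  · push_cast; ring
  · rw [Set.disjoint_left]
    rintro _ ⟨i, rfl⟩ ⟨j, hj⟩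
    exact hfg i j hj.symm
  · rw [Set.disjoint_left]
    rintro _ (⟨i, rfl⟩ | ⟨i, rfl⟩) ⟨j, hj⟩
    · exact hfh i j hj.symm
    · exact hgh i j hj.symm

theorem four_le_encard {α : Type*} {s : Set α} {x₁ x₂ x₃ x₄ : α} (h₁ : x₁ ∈ s) (h₂ : x₂ ∈ s)
    (h₃ : x₃ ∈ s) (h₄ : x₄ ∈ s) (h12 : x₁ ≠ x₂) (h13 : x₁ ≠ x₃) (h14 : x₁ ≠ x₄) (h23 : x₂ ≠ x₃)
    (h24 : x₂ ≠ x₄) (h34 : x₃ ≠ x₄) : 4 ≤ s.encard := by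
  have h : ({x₁, x₂, x₃, x₄} : Set α).encard = 4 := by
    rw [Set.encard_insert_of_notMem (by simp [*]), Set.encard_insert_of_notMem (by simp [*]),
      Set.encard_pair h34]
    norm_num
  rw [← h]
  refine Set.encard_le_encard ?_
  rintro x (rfl | rfl | rfl | rfl) <;> assumption

variable {κ : ℝ} {J : JacobiFunctions κ} {b : OrthonormalBasis (Fin 2) ℝ Plane} {O : Plane}
  {A u τ : ℝ} {m : ℕ} {L : ZMod m → AffineSubspace ℝ Plane}

theorem two_mul_cast_ne_zero {k : ℕ} (h0 : 0 < k) (h : 2 * k < m) :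
    2 * (((k : ℕ) : ℤ) : ZMod m) ≠ 0 := by
  intro he
  have : ((2 * k : ℕ) : ZMod m) = 0 := by push_cast at he ⊢; exact he
  rw [ZMod.natCast_eq_zero_iff] at this
  have := Nat.le_of_dvd (by omega) this
  omega

namespace IsJacobiProgression

theorem gridCenter_injective (hκ : κ ^ 2 < 1) (hA : 0 < A)
    (H : IsJacobiProgression J b O A u τ L) [NeZero m] {k l : ℤ} (hk : 2 * (k : ZMod m) ≠ 0)
    (hl : 2 * (l : ZMod m) ≠ 0) :
    Function.Injective fun i : ZMod m => gridCenter J b O A u τ i.val k l := fun i j h => by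
  simpa using H.index_eq_of_gridCenter_eq hκ hA (H.cn_half_ne_zero hκ hk)
    (H.cn_half_ne_zero hκ hl) h

theorem wedgeLine_injective (hκ : κ ^ 2 < 1) (hA : 0 < A)
    (H : IsJacobiProgression J b O A u τ L) [NeZero m] {k : ℤ} (hk : 2 * (k : ZMod m) ≠ 0) :
    Function.Injective fun i : ZMod m => wedgeLine J b O A u τ i.val k := fun i j h => by
  simpa using H.index_eq_of_wedgeLine_eq hκ hA (H.cn_half_ne_zero hκ hk) h

theorem gridCenter_ne_of_type_ne (hκ : κ ^ 2 < 1) (hA : 0 < A)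
    (H : IsJacobiProgression J b O A u τ L) {k l l' : ℕ} (hk0 : 0 < k) (hk : 2 * k < m)
    (hl0 : 0 < l) (hl : 2 * l < m) (hl0' : 0 < l') (hl' : 2 * l' < m) (hne : l ≠ l') (i j : ℤ) :
    gridCenter J b O A u τ i k l ≠ gridCenter J b O A u τ j k l' := fun h =>
  hne (H.type_eq_of_gridCenter_eq hκ hA hl0 hl hl'
    (H.cn_half_ne_zero hκ (two_mul_cast_ne_zero hk0 hk))
    (by exact_mod_cast H.cn_half_ne_zero hκ (two_mul_cast_ne_zero hl0 hl))
    (by exact_mod_cast H.cn_half_ne_zero hκ (two_mul_cast_ne_zero hl0' hl')) h)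

theorem gridCenter_ne_of_index_ne (hκ : κ ^ 2 < 1) (hA : 0 < A)
    (H : IsJacobiProgression J b O A u τ L) {i j k l : ℤ} (hk : 2 * (k : ZMod m) ≠ 0)
    (hl : 2 * (l : ZMod m) ≠ 0) (hij : (i : ZMod m) ≠ j) :
    gridCenter J b O A u τ i k l ≠ gridCenter J b O A u τ j k l := fun h =>
  hij (H.index_eq_of_gridCenter_eq hκ hA (H.cn_half_ne_zero hκ hk) (H.cn_half_ne_zero hκ hl) h)

theorem wedgeLine_ne_of_type_ne (hκ : κ ^ 2 < 1) (hA : 0 < A)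
    (H : IsJacobiProgression J b O A u τ L) {k k' : ℕ} (hk0 : 0 < k) (hk : 2 * k < m)
    (hk0' : 0 < k') (hk' : 2 * k' < m) (hne : k ≠ k') (i j : ℤ) :
    wedgeLine J b O A u τ i k ≠ wedgeLine J b O A u τ j k' := fun h =>
  hne (H.type_eq_of_wedgeLine_eq hκ hA hk0 hk hk'
    (by exact_mod_cast H.cn_half_ne_zero hκ (two_mul_cast_ne_zero hk0 hk))
    (by exact_mod_cast H.cn_half_ne_zero hκ (two_mul_cast_ne_zero hk0' hk')) h)

theorem wedgeLine_ne_of_index_ne (hκ : κ ^ 2 < 1) (hA : 0 < A)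
    (H : IsJacobiProgression J b O A u τ L) {i j k : ℤ} (hk : 2 * (k : ZMod m) ≠ 0)
    (hij : (i : ZMod m) ≠ j) : wedgeLine J b O A u τ i k ≠ wedgeLine J b O A u τ j k := fun h =>
  hij (H.index_eq_of_wedgeLine_eq hκ hA (H.cn_half_ne_zero hκ hk) h)

/-- The types $l\neq l'$ provide two distinct centers on the bisector, so the span is the whole
line. In the configuration these are the other two of the three given types. -/
theorem affineSpan_wedgeCenters (hκ : κ ^ 2 < 1) (hA : 0 < A)
    (H : IsJacobiProgression J b O A u τ L) [NeZero m] {k l l' : ℕ} (hk0 : 0 < k)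
    (hk : 2 * k < m) (hl0 : 0 < l) (hl : 2 * l < m) (hl0' : 0 < l') (hl' : 2 * l' < m)
    (hne : l ≠ l') (i : ℤ) :
    affineSpan ℝ (wedgeCenters O L i k) = wedgeLine J b O A u τ i k := by
  have k2 := two_mul_cast_ne_zero hk0 hk
  have h1 := H.gridCenter_mem_wedgeCenters hκ hA i k2 (two_mul_cast_ne_zero hl0 hl)
  have h2 := H.gridCenter_mem_wedgeCenters hκ hA i k2 (two_mul_cast_ne_zero hl0' hl')
  have h3 : ∀ z ∈ wedgeCenters O L i ((k : ℤ) : ZMod m), z ∈ wedgeLine J b O A u τ i k :=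
    fun z hz => H.wedgeCenters_subset hκ hA hz
  rw [Int.cast_natCast] at h1 h2 h3
  exact affineSpan_eq_planeLine (bisector_normal_ne_zero (H.cn_half_ne_zero hκ k2) _)
    (H.gridCenter_ne_of_type_ne hκ hA hk0 hk hl0 hl hl0' hl' hne i i) h1 h2 h3

theorem cast_sub_ne {i k : ℤ} (hk : 2 * (k : ZMod m) ≠ 0) : (i : ZMod m) ≠ ((i - k : ℤ)) := by
  intro h
  push_cast at h
  exact hk (by linear_combination 2 * h)

theorem cast_add_ne {i k : ℤ} (hk : 2 * (k : ZMod m) ≠ 0) : (i : ZMod m) ≠ ((i + k : ℤ)) := by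
  intro h
  push_cast at h
  exact hk (by linear_combination -2 * h)

/-- Four of the centers lie on each bisector. -/
theorem four_points_on_wedgeLine (hκ : κ ^ 2 < 1) (hA : 0 < A)
    (H : IsJacobiProgression J b O A u τ L) {k l l' : ℕ} (hk0 : 0 < k)
    (hk : 2 * k < m) (hl0 : 0 < l) (hl : 2 * l < m) (hl0' : 0 < l') (hl' : 2 * l' < m)
    (hne : l ≠ l') (i : ℤ) {P : Set Plane} (hP : squareCenters O L k l ⊆ P)
    (hP' : squareCenters O L k l' ⊆ P) :
    4 ≤ {z ∈ P | z ∈ wedgeLine J b O A u τ i k}.encard := by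
  have k2 := two_mul_cast_ne_zero hk0 hk
  have l2 := two_mul_cast_ne_zero hl0 hl
  have l2' := two_mul_cast_ne_zero hl0' hl'
  have mem : ∀ {n : ℕ} (j : ℤ), 2 * (((n : ℕ) : ℤ) : ZMod m) ≠ 0 → squareCenters O L k n ⊆ P →
      gridCenter J b O A u τ j k n ∈ P := by
    intro n j n2 hn
    have := H.gridCenter_mem_squareCenters hκ hA j k2 n2
    rw [Int.cast_natCast, Int.cast_natCast] at this
    exact hn this
  have on : ∀ {n : ℕ}, 2 * (((n : ℕ) : ℤ) : ZMod m) ≠ 0 →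
      gridCenter J b O A u τ (i - n) k n ∈ wedgeLine J b O A u τ i k := by
    intro n n2
    have := (H.gridCenter_mem_wedgeLines hκ (i - n) k2 n2).2
    rwa [sub_add_cancel] at this
  have ne := H.gridCenter_ne_of_type_ne hκ hA hk0 hk hl0 hl hl0' hl' hne
  -- The bisector of $\ell_i$ and $\ell_{i+k}$ carries the centers at the positions $i$ and $i-l$,
  -- for each of the two partners $l$, $l'$ of $k$.
  exact four_le_encard
    ⟨mem i l2 hP, (H.gridCenter_mem_wedgeLines hκ i k2 l2).1⟩
    ⟨mem (i - l) l2 hP, on l2⟩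
    ⟨mem i l2' hP', (H.gridCenter_mem_wedgeLines hκ i k2 l2').1⟩
    ⟨mem (i - l') l2' hP', on l2'⟩
    (H.gridCenter_ne_of_index_ne hκ hA k2 l2 (cast_sub_ne l2)) (ne _ _) (ne _ _) (ne _ _) (ne _ _)
    (H.gridCenter_ne_of_index_ne hκ hA k2 l2' (cast_sub_ne l2'))

/-- Four of the bisectors pass through each center. -/
theorem four_lines_through_gridCenter (hκ : κ ^ 2 < 1) (hA : 0 < A)
    (H : IsJacobiProgression J b O A u τ L) {k l : ℕ} (hk0 : 0 < k)
    (hk : 2 * k < m) (hl0 : 0 < l) (hl : 2 * l < m) (hne : k ≠ l) (i : ℤ)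
    {Ls : Set (AffineSubspace ℝ Plane)} (hk' : ∀ j : ℤ, wedgeLine J b O A u τ j k ∈ Ls)
    (hl' : ∀ j : ℤ, wedgeLine J b O A u τ j l ∈ Ls) :
    4 ≤ {ℓ ∈ Ls | gridCenter J b O A u τ i k l ∈ ℓ}.encard := by
  have k2 := two_mul_cast_ne_zero hk0 hk
  have l2 := two_mul_cast_ne_zero hl0 hl
  have m1 := H.gridCenter_mem_wedgeLines hκ i k2 l2
  have m2 := H.gridCenter_mem_wedgeLines hκ i l2 k2
  rw [gridCenter_comm] at m2
  have ne := H.wedgeLine_ne_of_type_ne hκ hA hk0 hk hl0 hl hne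
  -- Opposite sides of the square cell give two bisectors of type $k$ and, by symmetry of the center
  -- in $k$ and $l$, two of type $l$.
  exact four_le_encard ⟨hk' i, m1.1⟩ ⟨hk' (i + l), m1.2⟩ ⟨hl' i, m2.1⟩ ⟨hl' (i + k), m2.2⟩
    (H.wedgeLine_ne_of_index_ne hκ hA k2 (cast_add_ne l2)) (ne _ _) (ne _ _) (ne _ _) (ne _ _)
    (H.wedgeLine_ne_of_index_ne hκ hA l2 (cast_add_ne k2))

/-- The centers and the bisectors form a pre-`(n₄)` configuration. -/
theorem isPreN4 (hκ : κ ^ 2 < 1) (hA : 0 < A) (H : IsJacobiProgression J b O A u τ L) [NeZero m]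
    {k l n : ℕ} (hk0 : 0 < k) (hk : 2 * k < m) (hl0 : 0 < l) (hl : 2 * l < m) (hn0 : 0 < n)
    (hn : 2 * n < m) (hkl : k ≠ l) (hln : l ≠ n) (hnk : n ≠ k) :
    IsPreN4 (3 * m) (squareCenters O L k l ∪ squareCenters O L l n ∪ squareCenters O L n k)
      {ℓ | ∃ (i : ZMod m) (d : ℕ), (d = k ∨ d = l ∨ d = n) ∧
        ℓ = affineSpan ℝ (wedgeCenters O L i d)} := by
  have k2 := two_mul_cast_ne_zero hk0 hk
  have l2 := two_mul_cast_ne_zero hl0 hl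
  have n2 := two_mul_cast_ne_zero hn0 hn
  have skl := H.squareCenters_eq_range hκ hA k2 l2
  have sln := H.squareCenters_eq_range hκ hA l2 n2
  have snk := H.squareCenters_eq_range hκ hA n2 k2
  have ckl := H.squareCenters_comm hκ hA k2 l2
  have cln := H.squareCenters_comm hκ hA l2 n2
  have cnk := H.squareCenters_comm hκ hA n2 k2
  simp only [Int.cast_natCast] at skl sln snk ckl cln cnk
  have val : ∀ i : ZMod m, (((i.val : ℕ) : ℤ) : ZMod m) = i := fun i => by simp
  have ak := H.affineSpan_wedgeCenters hκ hA hk0 hk hl0 hl hn0 hn hln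
  have al := H.affineSpan_wedgeCenters hκ hA hl0 hl hn0 hn hk0 hk hnk
  have an := H.affineSpan_wedgeCenters hκ hA hn0 hn hk0 hk hl0 hl hkl
  have ak' : ∀ i : ZMod m, affineSpan ℝ (wedgeCenters O L i k) =
      wedgeLine J b O A u τ i.val k := fun i => by rw [← ak, val]
  have al' : ∀ i : ZMod m, affineSpan ℝ (wedgeCenters O L i l) =
      wedgeLine J b O A u τ i.val l := fun i => by rw [← al, val]
  have an' : ∀ i : ZMod m, affineSpan ℝ (wedgeCenters O L i n) =
      wedgeLine J b O A u τ i.val n := fun i => by rw [← an, val]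
  have hLs : {ℓ | ∃ (i : ZMod m) (d : ℕ), (d = k ∨ d = l ∨ d = n) ∧
      ℓ = affineSpan ℝ (wedgeCenters O L i d)} =
      (Set.range fun i : ZMod m => wedgeLine J b O A u τ i.val k) ∪
      (Set.range fun i : ZMod m => wedgeLine J b O A u τ i.val l) ∪
      (Set.range fun i : ZMod m => wedgeLine J b O A u τ i.val n) := by
    ext ℓ
    constructor
    · rintro ⟨i, d, rfl | rfl | rfl, rfl⟩
      · exact Or.inl (Or.inl ⟨i, (ak' i).symm⟩)
      · exact Or.inl (Or.inr ⟨i, (al' i).symm⟩)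
      · exact Or.inr ⟨i, (an' i).symm⟩
    · rintro ((⟨i, rfl⟩ | ⟨i, rfl⟩) | ⟨i, rfl⟩)
      · exact ⟨i, k, Or.inl rfl, (ak' i).symm⟩
      · exact ⟨i, l, Or.inr (Or.inl rfl), (al' i).symm⟩
      · exact ⟨i, n, Or.inr (Or.inr rfl), (an' i).symm⟩
  have mk : ∀ j : ℤ, wedgeLine J b O A u τ j k ∈ {ℓ | ∃ (i : ZMod m) (d : ℕ),
      (d = k ∨ d = l ∨ d = n) ∧ ℓ = affineSpan ℝ (wedgeCenters O L i d)} :=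
    fun j => ⟨j, k, Or.inl rfl, (ak j).symm⟩
  have ml : ∀ j : ℤ, wedgeLine J b O A u τ j l ∈ {ℓ | ∃ (i : ZMod m) (d : ℕ),
      (d = k ∨ d = l ∨ d = n) ∧ ℓ = affineSpan ℝ (wedgeCenters O L i d)} :=
    fun j => ⟨j, l, Or.inr (Or.inl rfl), (al j).symm⟩
  have mn : ∀ j : ℤ, wedgeLine J b O A u τ j n ∈ {ℓ | ∃ (i : ZMod m) (d : ℕ),
      (d = k ∨ d = l ∨ d = n) ∧ ℓ = affineSpan ℝ (wedgeCenters O L i d)} :=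
    fun j => ⟨j, n, Or.inr (Or.inr rfl), (an j).symm⟩
  have nz : ∀ {d : ℕ} (j : ℤ), 2 * (((d : ℕ) : ℤ) : ZMod m) ≠ 0 →
      Module.finrank ℝ (wedgeLine J b O A u τ j d).direction = 1 ∧
        (wedgeLine J b O A u τ j d : Set Plane).Nonempty := fun j d2 =>
    have h0 := bisector_normal_ne_zero (H.cn_half_ne_zero hκ d2) _
    ⟨finrank_direction_planeLine h0, planeLine_nonempty h0⟩
  constructor
  · rw [skl, sln, snk]
    refine encard_range_union_range_union_range (H.gridCenter_injective hκ hA k2 l2)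
      (H.gridCenter_injective hκ hA l2 n2) (H.gridCenter_injective hκ hA n2 k2) ?_ ?_ ?_ <;>
      intro i j
    -- Any two of the three classes share a type; symmetry moves it to the first slot, as
    -- `gridCenter_ne_of_type_ne` requires.
    · simp only [gridCenter_comm _ (k : ℤ) l]
      exact H.gridCenter_ne_of_type_ne hκ hA hl0 hl hk0 hk hn0 hn hnk.symm _ _
    · simp only [gridCenter_comm _ (l : ℤ) n]
      exact H.gridCenter_ne_of_type_ne hκ hA hn0 hn hl0 hl hk0 hk hkl.symm _ _
    · simp only [gridCenter_comm _ (n : ℤ) k]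
      exact H.gridCenter_ne_of_type_ne hκ hA hk0 hk hl0 hl hn0 hn hln _ _
  · rw [hLs]
    refine encard_range_union_range_union_range (H.wedgeLine_injective hκ hA k2)
      (H.wedgeLine_injective hκ hA l2) (H.wedgeLine_injective hκ hA n2) ?_ ?_ ?_ <;> intro i j
    · exact H.wedgeLine_ne_of_type_ne hκ hA hk0 hk hl0 hl hkl _ _
    · exact H.wedgeLine_ne_of_type_ne hκ hA hl0 hl hn0 hn hln _ _
    · exact H.wedgeLine_ne_of_type_ne hκ hA hk0 hk hn0 hn hnk.symm _ _
  · rw [hLs]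
    rintro ℓ ((⟨i, rfl⟩ | ⟨i, rfl⟩) | ⟨i, rfl⟩)
    exacts [nz _ k2, nz _ l2, nz _ n2]
  · have p1 : squareCenters O L (k : ZMod m) l ⊆
      squareCenters O L k l ∪ squareCenters O L l n ∪ squareCenters O L n k := fun _ h => .inl (.inl h)
    have p2 : squareCenters O L (l : ZMod m) n ⊆
      squareCenters O L k l ∪ squareCenters O L l n ∪ squareCenters O L n k := fun _ h => .inl (.inr h)
    have p3 : squareCenters O L (n : ZMod m) k ⊆
      squareCenters O L k l ∪ squareCenters O L l n ∪ squareCenters O L n k := fun _ h => .inr h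
    intro ℓ hℓ
    rw [hLs] at hℓ
    rcases hℓ with (⟨i, rfl⟩ | ⟨i, rfl⟩) | ⟨i, rfl⟩
    · exact H.four_points_on_wedgeLine hκ hA hk0 hk hl0 hl hn0 hn hln _ p1 (cnk ▸ p3)
    · exact H.four_points_on_wedgeLine hκ hA hl0 hl hn0 hn hk0 hk hnk _ p2 (ckl ▸ p1)
    · exact H.four_points_on_wedgeLine hκ hA hn0 hn hk0 hk hl0 hl hkl _ p3 (cln ▸ p2)
  · intro z hz
    rw [skl, sln, snk] at hz
    rcases hz with (⟨i, rfl⟩ | ⟨i, rfl⟩) | ⟨i, rfl⟩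
    · exact H.four_lines_through_gridCenter hκ hA hk0 hk hl0 hl hkl _ mk ml
    · exact H.four_lines_through_gridCenter hκ hA hl0 hl hn0 hn hln _ ml mn
    · exact H.four_lines_through_gridCenter hκ hA hn0 hn hk0 hk hnk _ mn mk

end IsJacobiProgression

end PonceletIncircle

end

/-! ### Assembly. -/

theorem mainTheorem7 (F₁ F₂ : PonceletIncircle.Plane) (s t : ℝ)
    (hs : dist F₁ F₂ < 2 * s) (hst : s < t) (m : ℕ) (hm : 3 ≤ m)
    (p : ZMod m → PonceletIncircle.Plane)
    (hp : PonceletIncircle.IsPonceletPolygon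
      (PonceletIncircle.ellipse F₁ F₂ t) (PonceletIncircle.ellipse F₁ F₂ s) p)
    (O : PonceletIncircle.Plane) (hO : O = midpoint ℝ F₁ F₂)
    (L : ZMod m → AffineSubspace ℝ PonceletIncircle.Plane)
    (hL : L = PonceletIncircle.side p) :
    (∀ i k l : ZMod m, 2 * k ≠ 0 → 2 * l ≠ 0 →
      ∃! S : EuclideanGeometry.Sphere PonceletIncircle.Plane,
        PonceletIncircle.IsSquareIncircle O L i k l S) ∧
    (∀ i k : ZMod m, 2 * k ≠ 0 → Collinear ℝ (PonceletIncircle.wedgeCenters O L i k)) ∧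
    (∀ a b c : ℕ, 0 < a → 2 * a < m → 0 < b → 2 * b < m → 0 < c → 2 * c < m →
      a ≠ b → b ≠ c → c ≠ a →
      PonceletIncircle.IsPreN4 (3 * m)
        (PonceletIncircle.squareCenters O L a b ∪ PonceletIncircle.squareCenters O L b c ∪
          PonceletIncircle.squareCenters O L c a)
        {ℓ | ∃ (i : ZMod m) (d : ℕ), (d = a ∨ d = b ∨ d = c) ∧
          ℓ = affineSpan ℝ (PonceletIncircle.wedgeCenters O L i d)}) := by
  subst hO hL
  have : NeZero m := ⟨by omega⟩
  have hf : 0 ≤ dist F₁ F₂ / 2 := by positivity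
  have hfs : dist F₁ F₂ / 2 < s := by linarith
  have hs0 : 0 < s := hf.trans_lt hfs
  -- The modulus is the eccentricity of the inner ellipse; it is zero for concentric circles, which
  -- need no separate treatment.
  have hκ0 : 0 ≤ dist F₁ F₂ / 2 / s := by positivity
  have hκ1 : dist F₁ F₂ / 2 / s < 1 := (div_lt_one hs0).2 hfs
  have hκ : (dist F₁ F₂ / 2 / s) ^ 2 < 1 := by nlinarith
  obtain ⟨J⟩ := PonceletIncircle.nonempty_jacobiFunctions hκ0 hκ1
  obtain ⟨e, h1, h2⟩ := PonceletIncircle.exists_frame F₁ F₂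
  obtain ⟨u, τ, H⟩ := PonceletIncircle.exists_isJacobiProgression (J := J) hκ h1 h2 hf hfs hst
    (div_mul_cancel₀ _ hs0.ne') hm hp
  have lift : ∀ i : ZMod m, ∃ j : ℤ, (j : ZMod m) = i := ZMod.intCast_surjective
  refine ⟨fun i k l hk hl => ?_, fun i k hk => ?_, fun a b c ha ha' hb hb' hc hc' hab hbc hca =>
    H.isPreN4 hκ hs0 ha ha' hb hb' hc hc' hab hbc hca⟩
  · obtain ⟨i, rfl⟩ := lift i
    obtain ⟨k, rfl⟩ := lift k
    obtain ⟨l, rfl⟩ := lift l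
    exact ⟨_, (H.isSquareIncircle_iff hκ hs0 hk hl).2 rfl,
      fun S hS => (H.isSquareIncircle_iff hκ hs0 hk hl).1 hS⟩
  · obtain ⟨i, rfl⟩ := lift i
    obtain ⟨k, rfl⟩ := lift k
    exact H.collinear_wedgeCenters hκ hs0 i hk
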